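/- Let $X$ be a finite-dimensional real or complex inner product space (the inner product is conjugate-linear in its first entry in the complex case). For subspaces $V,W\subset X$ let $p=\dim V$, $q=\dim W$, $m=\min\{p,q\}$. The principal angles $0\le\theta_1\le\dots\le\theta_m\le\frac{\pi}{2}$ of $V$ and $W$ are determined by $\langle e_i,f_j\rangle=\delta_{ij}\cos\theta_i$ for suitable orthonormal bases $(e_1,\dots,e_p)$ of $V$ and $(f_1,\dots,f_q)$ of $W$. The Grassmann angle of $V$ with $W$ is $\Theta_{V,W}=\arccos(\cos\theta_1\cdots\cos\theta_m)$ if $p\le q$ (so $\Theta_{\{0\},W}=0$), and $\Theta_{V,W}=\frac{\pi}{2}$ if $p>q$. We say that $V$ is partially orthogonal to $W$ if $V\cap W^\perp\neq\{0\}$. We write $P_W$ for the orthogonal projection onto $W$ and, for nonzero $x,y\in X$, $\theta_{x,y}=\arccos\frac{\operatorname{Re}\langle x,y\rangle}{\|x\|\,\|y\|}$. **Proposition.** Let $U,V,W\subset X$ be subspaces. Then $$\Theta_{U,W}=\Theta_{U,V}+\Theta_{V,W}$$ if, and only if, at least one of the following conditions holds: (i) $U\subset V$, and $U$ is partially orthogonal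 to $W$ or $U^\perp\cap V\subset W$; (ii) $V\subset W$, and $U$ is partially orthogonal to $W$ or $P_W(U)\subset V$; (iii) there are nonzero vectors $u,w\in X$ with $\langle u,w\rangle$ real and $\langle u,w\rangle\ge 0$, a vector $v=au+bw$ with real $a,b>0$, and subspaces $A,B,C\subset X$ orthogonal to $\operatorname{span}(u,w)$ and to each other, such that $$U=\operatorname{span}(u)\oplus A,\qquad V=\operatorname{span}(v)\oplus A\oplus B,\qquad W=\operatorname{span}(w)\oplus A\oplus B\oplus C.$$ Moreover, for any $u,v,w$ as in (iii), $\theta_{u,v}=\Theta_{U,V}$, $\theta_{u,w}=\Theta_{U,W}$ and $\theta_{v,w}=\Theta_{V,W}$. -/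

import Mathlib

open Module

section GrassmannAngle

variable {𝕜 X : Type*} [RCLike 𝕜] [NormedAddCommGroup X] [InnerProductSpace 𝕜 X]

/-- The Euclidean angle `θ_{v,w} ∈ [0, π]` of two vectors of a real or complex inner product space,
`cos θ_{v,w} = Re ⟨v,w⟩ / (‖v‖ ‖w‖)`, with the conventions `θ_{0,w} = 0` and `θ_{v,0} = π/2` for
`v ≠ 0` (the latter comes out of `x / 0 = 0` and `arccos 0 = π/2`). -/
noncomputable def euclideanAngle (𝕜 : Type*) {X : Type*} [RCLike 𝕜] [NormedAddCommGroup X]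
    [InnerProductSpace 𝕜 X] (v w : X) : ℝ :=
  open Classical in
  if v = 0 then 0 else Real.arccos (RCLike.re (inner 𝕜 v w) / (‖v‖ * ‖w‖))

/-- `V` is partially orthogonal to `W`: some nonzero vector of `V` is orthogonal to all of `W`. -/
def PartiallyOrthogonal (V W : Submodule 𝕜 X) : Prop :=
  ∃ v ∈ V, v ≠ 0 ∧ ∀ w ∈ W, inner 𝕜 v w = 0

/-- Orthonormal bases `e` of `V` and `f` of `W` are associated principal bases, with principal
angles `0 ≤ θ₁ ≤ … ≤ θₘ ≤ π/2`, `m = min (dim V) (dim W)`, if `⟨eᵢ, fⱼ⟩ = δᵢⱼ cos θᵢ`. -/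
structure IsPrincipalSystem (V W : Submodule 𝕜 X)
    (e : OrthonormalBasis (Fin (finrank 𝕜 V)) 𝕜 V) (f : OrthonormalBasis (Fin (finrank 𝕜 W)) 𝕜 W)
    (θ : Fin (min (finrank 𝕜 V) (finrank 𝕜 W)) → ℝ) : Prop where
  monotone : Monotone θ
  nonneg : ∀ i, 0 ≤ θ i
  le_pi_div_two : ∀ i, θ i ≤ Real.pi / 2
  inner_eq : ∀ (i : Fin (finrank 𝕜 V)) (j : Fin (finrank 𝕜 W)),
    inner 𝕜 (e i : X) (f j : X) =
      if h : i.val = j.val then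
        ((Real.cos (θ ⟨i.val, lt_min i.isLt (h ▸ j.isLt)⟩) : ℝ) : 𝕜)
      else 0

/-- The vectors `u`, `v = a u + b w`, `w` and the subspaces `A`, `B`, `C` decompose `U`, `V`, `W`.
The three vectors lie in `span (u, w)`, so the orthogonality conditions make all the sums
in the last three fields direct. -/
structure IsAlignedDecomposition (U V W : Submodule 𝕜 X) (u v w : X) (a b : ℝ)
    (A B C : Submodule 𝕜 X) : Prop where
  u_ne_zero : u ≠ 0
  w_ne_zero : w ≠ 0
  inner_im : RCLike.im (inner 𝕜 u w) = 0
  inner_re : 0 ≤ RCLike.re (inner 𝕜 u w)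
  a_pos : 0 < a
  b_pos : 0 < b
  v_eq : v = (a : 𝕜) • u + (b : 𝕜) • w
  orthoA : A ⟂ Submodule.span 𝕜 {u, w}
  orthoB : B ⟂ Submodule.span 𝕜 {u, w}
  orthoC : C ⟂ Submodule.span 𝕜 {u, w}
  orthoAB : A ⟂ B
  orthoAC : A ⟂ C
  orthoBC : B ⟂ C
  U_eq : U = Submodule.span 𝕜 {u} ⊔ A
  V_eq : V = Submodule.span 𝕜 {v} ⊔ A ⊔ B
  W_eq : W = Submodule.span 𝕜 {w} ⊔ A ⊔ B ⊔ C

variable [FiniteDimensional 𝕜 X]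

/-- Principal bases exist (singular value decomposition of the projection `V → W`). -/
theorem exists_isPrincipalSystem (V W : Submodule 𝕜 X) :
    ∃ (θ : Fin (min (finrank 𝕜 V) (finrank 𝕜 W)) → ℝ)
      (e : OrthonormalBasis (Fin (finrank 𝕜 V)) 𝕜 V)
      (f : OrthonormalBasis (Fin (finrank 𝕜 W)) 𝕜 W), IsPrincipalSystem V W e f θ := by
  classical
  set T : V →ₗ[𝕜] W := (W.orthogonalProjectionOnto : X →ₗ[𝕜] W) ∘ₗ V.subtype with hT
  have hTa : ∀ v : V, T v = W.orthogonalProjectionOnto (v : X) := fun v => rfl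
  set e := T.isSymmetric_adjoint_comp_self.eigenvectorBasis rfl with he
  have hgram : ∀ i j, inner 𝕜 (T (e i)) (T (e j)) =
      if i = j then (((T.singularValues j) ^ 2 : ℝ) : 𝕜) else 0 := by
    intro i j
    rw [← LinearMap.adjoint_inner_right, ← LinearMap.comp_apply, he,
      T.isSymmetric_adjoint_comp_self.apply_eigenvectorBasis rfl j, inner_smul_right,
      orthonormal_iff_ite.mp (OrthonormalBasis.orthonormal _) i j,
      ← T.sq_singularValues_fin rfl j]
    split_ifs <;> simp
  have hnorm : ∀ i, ‖T (e i)‖ = T.singularValues i := by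
    intro i
    have h1 := hgram i i
    rw [if_pos rfl, inner_self_eq_norm_sq_to_K] at h1
    have h2 : ‖T (e i)‖ ^ 2 = T.singularValues i ^ 2 := by exact_mod_cast h1
    exact (sq_eq_sq₀ (norm_nonneg _) (T.singularValues_nonneg i)).mp h2
  have hle1 : ∀ i : Fin (finrank 𝕜 V), T.singularValues i ≤ 1 := by
    intro i
    rw [← hnorm i, hTa]
    refine (W.norm_orthogonalProjectionOnto_apply_le _).trans ?_
    exact (e.norm_eq_one i).le
  have hpos : ∀ i, T.singularValues i ≠ 0 → i < finrank 𝕜 W := by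
    intro i hi
    exact (T.singularValues_pos_iff_lt_finrank_range.mp
      ((T.singularValues_pos_iff_ne_zero i).mpr hi)).trans_le (Submodule.finrank_le _)
  let v : Fin (finrank 𝕜 W) → W := fun j =>
    if h : j.val < finrank 𝕜 V then
      (((T.singularValues j)⁻¹ : ℝ) : 𝕜) • T (e ⟨j.val, h⟩) else 0
  let s : Set (Fin (finrank 𝕜 W)) := {j | j.val < finrank 𝕜 V ∧ T.singularValues j ≠ 0}
  have hv : Orthonormal 𝕜 (s.domRestrict v) := by
    rw [orthonormal_iff_ite]
    rintro ⟨i, hi, hi0⟩ ⟨j, hj, hj0⟩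
    simp only [Set.domRestrict_apply, v, dif_pos hi, dif_pos hj, inner_smul_left, inner_smul_right,
      hgram, Subtype.mk.injEq, Fin.ext_iff]
    split_ifs with h
    · have : (T.singularValues i.val : ℝ) = T.singularValues j.val := by rw [h]
      rw [this, RCLike.conj_ofReal]
      norm_cast
      field_simp
    · simp
  obtain ⟨f, hf⟩ := hv.exists_orthonormalBasis_extension_of_card_eq (by simp)
  refine ⟨fun i => Real.arccos (T.singularValues i), e, f, ?_, ?_, ?_, ?_⟩
  · intro i j hij
    exact Real.arccos_le_arccos (T.singularValues_antitone hij)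
  · exact fun i => Real.arccos_nonneg _
  · intro i
    exact Real.arccos_le_pi_div_two.mpr (T.singularValues_nonneg i)
  · intro i j
    have h1 : inner 𝕜 (e i : X) (f j : X) = inner 𝕜 (T (e i)) (f j) := by
      rw [hTa, Submodule.inner_orthogonalProjectionOnto_eq_of_mem_right]
    rw [h1]
    have h2 : T (e i) = 0 → T.singularValues i = 0 := fun h => by rw [← hnorm i, h, norm_zero]
    by_cases h0 : T.singularValues i = 0
    · have : T (e i) = 0 := by rw [← norm_eq_zero, hnorm i, h0]
      rw [this, inner_zero_left]
      split_ifs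
      · simp [h0]
      · rfl
    · have hi := hpos i h0
      have hk : (⟨i.val, hi⟩ : Fin (finrank 𝕜 W)) ∈ s := ⟨i.isLt, h0⟩
      have h3 := hf _ hk
      simp only [v, dif_pos i.isLt] at h3
      have h4 : T (e i) = ((T.singularValues i : ℝ) : 𝕜) • f ⟨i.val, hi⟩ := by
        rw [h3, smul_smul]
        have : ((T.singularValues i : ℝ) : 𝕜) ≠ 0 := by exact_mod_cast h0
        rw [RCLike.ofReal_inv, mul_inv_cancel₀ this, one_smul]
      rw [h4, inner_smul_left, orthonormal_iff_ite.mp f.orthonormal, RCLike.conj_ofReal]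
      simp only [Fin.ext_iff]
      split_ifs with h
      · rw [Real.cos_arccos (by linarith [T.singularValues_nonneg i]) (hle1 i), mul_one]
      · simp

/-- The principal angles `θ₁ ≤ … ≤ θₘ` of `V` and `W`. -/
noncomputable def principalAngle (V W : Submodule 𝕜 X) :
    Fin (min (finrank 𝕜 V) (finrank 𝕜 W)) → ℝ :=
  (exists_isPrincipalSystem V W).choose

/-- The Grassmann angle `Θ_{V,W}` of `V` with `W`. When `V = 0` the product is empty, so that
`Θ_{0,W} = arccos 1 = 0`; when `V ≠ 0 = W` the second case gives `Θ_{V,0} = π/2`. -/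
noncomputable def grassmannAngle (V W : Submodule 𝕜 X) : ℝ :=
  if finrank 𝕜 V ≤ finrank 𝕜 W then Real.arccos (∏ i, Real.cos (principalAngle V W i))
  else Real.pi / 2

/-- The Grassmann angle may be computed from any principal bases: `∏ cos θᵢ` is the volume
contraction factor of the projection `V → W`. -/
theorem IsPrincipalSystem.prod_cos_eq_normDet {V W : Submodule 𝕜 X}
    {e : OrthonormalBasis (Fin (finrank 𝕜 V)) 𝕜 V} {f : OrthonormalBasis (Fin (finrank 𝕜 W)) 𝕜 W}
    {θ : Fin (min (finrank 𝕜 V) (finrank 𝕜 W)) → ℝ} (h : IsPrincipalSystem V W e f θ)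
    (hVW : finrank 𝕜 V ≤ finrank 𝕜 W) :
    ∏ i, Real.cos (θ i) =
      ((W.orthogonalProjectionOnto : X →ₗ[𝕜] W) ∘ₗ V.subtype).normDet := by
  classical
  set T : V →ₗ[𝕜] W := (W.orthogonalProjectionOnto : X →ₗ[𝕜] W) ∘ₗ V.subtype with hT
  have hcos : ∀ i, 0 ≤ Real.cos (θ i) := fun i =>
    Real.cos_nonneg_of_neg_pi_div_two_le_of_le
      (by linarith [h.nonneg i, Real.pi_pos]) (h.le_pi_div_two i)
  have hTe : ∀ i : Fin (finrank 𝕜 V), T (e i) =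
      ((Real.cos (θ ⟨i.val, lt_min i.isLt (i.isLt.trans_le hVW)⟩) : ℝ) : 𝕜) •
        f ⟨i.val, i.isLt.trans_le hVW⟩ := by
    intro i
    refine f.repr.injective (PiLp.ext fun j => ?_)
    rw [f.repr_apply_apply, f.repr_apply_apply]
    have h1 : inner 𝕜 (f j : X) (e i : X) = inner 𝕜 (f j) (T (e i)) :=
      (Submodule.inner_orthogonalProjectionOnto_eq_of_mem_left (f j) (e i : X)).symm
    rw [← h1, ← inner_conj_symm, h.inner_eq, inner_smul_right,
      orthonormal_iff_ite.mp f.orthonormal]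
    simp only [Fin.ext_iff]
    by_cases hij : i.val = j.val
    · simp [hij]
    · simp [hij, Ne.symm hij]
  have hg : Matrix.gram 𝕜 (fun i => T (e i)) = Matrix.diagonal (fun i =>
      (((Real.cos (θ ⟨i.val, lt_min i.isLt (i.isLt.trans_le hVW)⟩)) ^ 2 : ℝ) : 𝕜)) := by
    ext i j
    rw [Matrix.gram_apply, hTe, hTe, inner_smul_left, inner_smul_right,
      orthonormal_iff_ite.mp f.orthonormal, Matrix.diagonal_apply]
    by_cases hij : i = j
    · subst hij
      simp [sq]
    · have : i.val ≠ j.val := fun h => hij (Fin.ext h)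
      simp [hij, this]
  have hsq := T.normDet_sq_eq_det_gram e
  rw [hg, Matrix.det_diagonal] at hsq
  have hsq' : T.normDet ^ 2 = (∏ i : Fin (finrank 𝕜 V),
      Real.cos (θ ⟨i.val, lt_min i.isLt (i.isLt.trans_le hVW)⟩)) ^ 2 := by
    rw [← Finset.prod_pow]
    exact_mod_cast hsq
  have hre : ∏ i, Real.cos (θ i) = ∏ i : Fin (finrank 𝕜 V),
      Real.cos (θ ⟨i.val, lt_min i.isLt (i.isLt.trans_le hVW)⟩) :=
    Fintype.prod_equiv (finCongr (min_eq_left hVW)) _ _ (fun i => rfl)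
  rw [hre]
  exact ((sq_eq_sq₀ T.normDet_nonneg (Finset.prod_nonneg fun i _ => hcos _)).mp hsq').symm

end GrassmannAngle

/-!
The cosine of `Θ(V, W)` is the factor by which the orthogonal projection `V → W` contracts volumes
(`grassmannCos`). In place of an exterior power, a family `v` is given a Plücker vector
`blade 𝕜 v` in a Euclidean space, with `⟪blade u, blade v⟫ = det ⟪u i, v j⟫` (`inner_blade`). Then
`cos Θ(V, W)` is the norm of the Plücker vector of the projections to `W` of an orthonormal basis
of `V` (`grassmannCos_eq_norm_blade`), and proportional nonzero Plücker vectors have the same span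
(`span_range_eq_of_blade_eq_smul`).

Suppose `Θ(U, W) = Θ(U, V) + Θ(V, W)`, with both summands below `π / 2`. Let `U'` be the projection
of `U` to `V`, and let `x`, `y`, `z` be the unit Plücker vectors of `U`, of `U'`, and of the
projection of `U'` to `W`. The triangle inequality for the angles of `x`, `y`, `z` gives
`Θ(U, W) ≤ Θ(U, V) + Θ(U', W)`, while `Θ(U', W) ≤ Θ(V, W)` because enlarging the first subspace
enlarges the angle. Both are equalities here (`exists_blade_eq_add`): the second one says that
`U'ᗮ ⊓ V ≤ W` (`grassmannCos_le_of_le`), and the first one says that `y = α x + β z` with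
nonnegative `α`, `β`. The case `α = 0` only occurs when `V ≤ W`, and then equality in the
Cauchy–Schwarz inequality shows that `U'` is also the projection of `U` to `W`, unless `U` is
partially orthogonal to `W` (`map_starProjection_le_of_grassmannCos_eq`). Since `z` is
decomposable, a three-term Plücker relation shows that, for `α ≠ 0`, at most one principal angle of
`U` and `V` is nonzero (`mul_prod_eq_zero_of_blade_eq_add`). If there is none, then `U ≤ V`. If
there is exactly one, with principal vectors `u` and `v`, then dividing out the common directions
of `U` and `V` turns the relation of Plücker vectors into the relation `v = α u + w` with `w ∈ W`
(`exists_isAlignedDecomposition`).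

In the other direction, directions common to both subspaces, or orthogonal to everything else,
do not affect the volume factor, so that the angles of an aligned decomposition are those of the
vectors `u`, `v`, `w` (`IsAlignedDecomposition.euclideanAngle_eq`), for which additivity holds in
the plane.
-/

section Blades

open scoped Matrix ComplexOrder

/-! ### Determinants -/

/-- The three-term Plücker relation. -/
theorem Matrix.det_mul_det_updateRow_updateRow {n K : Type*} [Fintype n] [DecidableEq n] [Field K]
    (M : Matrix n n K) (hM : M.det ≠ 0) {i j : n} (hij : i ≠ j) (r s : n → K) :
    M.det * ((M.updateRow i r).updateRow j s).det =
      (M.updateRow i r).det * (M.updateRow j s).det -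
        (M.updateRow i s).det * (M.updateRow j r).det := by
  -- expand `s` in the rows of `M`
  obtain ⟨c, hc⟩ : ∃ c : n → K, s = ∑ k, c k • M k := by
    refine ⟨s ᵥ* M⁻¹, ?_⟩
    have h1 : (s ᵥ* M⁻¹) ᵥ* M = s := by
      rw [Matrix.vecMul_vecMul, Matrix.nonsing_inv_mul _ (isUnit_iff_ne_zero.mpr hM),
        Matrix.vecMul_one]
    rw [← Matrix.vecMul_eq_sum, h1]
  have hi : (M.updateRow i s).det = c i * M.det := by
    rw [hc, Matrix.det_updateRow_sum, smul_eq_mul]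
  have hj : (M.updateRow j s).det = c j * M.det := by
    rw [hc, Matrix.det_updateRow_sum, smul_eq_mul]
  have hswap : ((M.updateRow i r).updateRow j (M i)).det = -(M.updateRow j r).det := by
    have h := Matrix.det_permute (Equiv.swap i j) (M.updateRow j r)
    rw [Equiv.Perm.sign_swap hij] at h
    have h2 : (M.updateRow j r).submatrix (Equiv.swap i j) id =
        (M.updateRow i r).updateRow j (M i) := by
      ext k l
      simp only [Matrix.submatrix_apply, id, Matrix.updateRow_apply]
      by_cases hki : k = i
      · subst hki
        simp [hij]
      · by_cases hkj : k = j
        · subst hkj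
          simp [hij]
        · simp [Equiv.swap_apply_of_ne_of_ne hki hkj, hki, hkj]
    rw [h2] at h
    rw [h]
    simp
  have key : ((M.updateRow i r).updateRow j s).det =
      c j * (M.updateRow i r).det - c i * (M.updateRow j r).det := by
    set N := M.updateRow i r with hN
    have hs : s = ∑ k, c k • N k + c i • (M i - r) := by
      rw [hc, ← Finset.add_sum_erase _ _ (Finset.mem_univ i),
        ← Finset.add_sum_erase _ _ (Finset.mem_univ i)]
      have : ∑ k ∈ Finset.univ.erase i, c k • N k = ∑ k ∈ Finset.univ.erase i, c k • M k := by
        refine Finset.sum_congr rfl fun k hk => ?_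
        rw [hN, Matrix.updateRow_ne (Finset.ne_of_mem_erase hk)]
      rw [this, hN, Matrix.updateRow_self, smul_sub]
      abel
    have hr : (N.updateRow j r).det = 0 :=
      Matrix.det_zero_of_row_eq hij (by
        rw [Matrix.updateRow_ne hij, Matrix.updateRow_self, hN, Matrix.updateRow_self])
    have hsub : (N.updateRow j (M i - r)).det = -(M.updateRow j r).det := by
      have := Matrix.det_updateRow_add N j (M i - r) r
      rw [sub_add_cancel, hswap, hr, add_zero] at this
      exact this.symm
    rw [hs, Matrix.det_updateRow_add, Matrix.det_updateRow_sum, Matrix.det_updateRow_smul, hsub,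
      smul_eq_mul]
    ring
  rw [key, hi, hj]
  ring

/-- A positive semidefinite matrix with diagonal entries at most `1` has determinant at most `1`:
each eigenvalue satisfies `l ≤ exp (l - 1)`, and the exponents add up to `trace S - n ≤ 0`. -/
theorem Matrix.PosSemidef.re_det_le_one {n 𝕜 : Type*} [Fintype n] [DecidableEq n] [RCLike 𝕜]
    {S : Matrix n n 𝕜} (hS : S.PosSemidef) (hd : ∀ i, RCLike.re (S i i) ≤ 1) :
    RCLike.re S.det ≤ 1 ∧ (1 ≤ RCLike.re S.det → ∀ i, RCLike.re (S i i) = 1) := by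
  have hdet : RCLike.re S.det = ∏ i, hS.1.eigenvalues i := by
    rw [hS.1.det_eq_prod_eigenvalues]
    norm_cast
  have htr : ∑ i, RCLike.re (S i i) = ∑ i, hS.1.eigenvalues i := by
    have := congrArg RCLike.re hS.1.trace_eq_sum_eigenvalues
    rw [Matrix.trace, map_sum, map_sum] at this
    simpa using this
  have hexp : RCLike.re S.det ≤ Real.exp (∑ i, RCLike.re (S i i) - Fintype.card n) := by
    rw [hdet, htr]
    have : ∑ i, hS.1.eigenvalues i - Fintype.card n = ∑ i, (hS.1.eigenvalues i - 1) := by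
      simp [Finset.sum_sub_distrib]
    rw [this, Real.exp_sum]
    refine Finset.prod_le_prod (fun i _ => hS.eigenvalues_nonneg i) fun i _ => ?_
    linarith [Real.add_one_le_exp (hS.1.eigenvalues i - 1)]
  have hle : ∑ i, RCLike.re (S i i) ≤ Fintype.card n := by
    simpa using Finset.sum_le_sum fun i (_ : i ∈ Finset.univ) => hd i
  refine ⟨hexp.trans (Real.exp_le_one_iff.mpr (by linarith)), fun h => ?_⟩
  have h1 : 0 ≤ ∑ i, RCLike.re (S i i) - Fintype.card n :=
    Real.one_le_exp_iff.mp (h.trans hexp)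
  have h2 : ∑ i, RCLike.re (S i i) = ∑ _i : n, (1 : ℝ) := by
    simp only [Finset.sum_const, Finset.card_univ, nsmul_eq_mul, mul_one]
    linarith
  have h3 := (Finset.sum_eq_sum_iff_of_le fun i _ => hd i).mp h2
  exact fun i => h3 i (Finset.mem_univ i)

/-! ### Plücker vectors -/

variable {𝕜 X : Type*} [RCLike 𝕜] [NormedAddCommGroup X] [InnerProductSpace 𝕜 X]
  [FiniteDimensional 𝕜 X]
variable {ι κ : Type*} [Fintype ι] [DecidableEq ι] [Fintype κ] [DecidableEq κ]

/-- The Plücker vector of a family `v`, standing for the exterior product of the `v i`. Its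
coordinates, in a fixed orthonormal basis of `X`, are all maximal minors with repetitions and in
every order, so the factor `1 / √p!` makes the norm the volume of the parallelotope. -/
noncomputable def blade (𝕜 : Type*) {X ι : Type*} [RCLike 𝕜] [NormedAddCommGroup X]
    [InnerProductSpace 𝕜 X] [FiniteDimensional 𝕜 X] [Fintype ι] [DecidableEq ι] (v : ι → X) :
    EuclideanSpace 𝕜 (ι → Fin (finrank 𝕜 X)) :=
  WithLp.toLp 2 fun s => (((√((Fintype.card ι).factorial : ℝ))⁻¹ : ℝ) : 𝕜) *
    (Matrix.of fun i k => inner 𝕜 (stdOrthonormalBasis 𝕜 X (s k)) (v i)).det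

theorem inner_blade (u v : ι → X) :
    inner 𝕜 (blade 𝕜 u) (blade 𝕜 v) = (Matrix.of fun i j => inner 𝕜 (u i) (v j)).det := by
  set b := stdOrthonormalBasis 𝕜 X
  set G : Matrix ι ι 𝕜 := Matrix.of fun i j => inner 𝕜 (u i) (v j) with hG
  have hsum : ∑ s : ι → Fin (finrank 𝕜 X),
      (starRingEnd 𝕜) (Matrix.of fun i k => inner 𝕜 (b (s k)) (u i)).det *
        (Matrix.of fun i k => inner 𝕜 (b (s k)) (v i)).det =
      ((Fintype.card ι).factorial : 𝕜) * G.det := by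
    have h1 : ∀ s : ι → Fin (finrank 𝕜 X),
        (starRingEnd 𝕜) (Matrix.of fun i k => inner 𝕜 (b (s k)) (u i)).det *
          (Matrix.of fun i k => inner 𝕜 (b (s k)) (v i)).det =
        ∑ σ : Equiv.Perm ι, ∑ τ : Equiv.Perm ι, ((Equiv.Perm.sign σ : ℤ) : 𝕜) *
          ((Equiv.Perm.sign τ : ℤ) : 𝕜) *
          ∏ k, (inner 𝕜 (u (σ k)) (b (s k)) * inner 𝕜 (b (s k)) (v (τ k))) := by
      intro s
      rw [Matrix.det_apply', Matrix.det_apply', map_sum, Finset.sum_mul_sum]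
      refine Finset.sum_congr rfl fun σ _ => Finset.sum_congr rfl fun τ _ => ?_
      rw [map_mul, map_prod, Finset.prod_mul_distrib]
      simp only [Matrix.of_apply, inner_conj_symm, map_intCast]
      ring
    rw [Finset.sum_congr rfl fun s _ => h1 s, Finset.sum_comm]
    have h2 : ∀ σ : Equiv.Perm ι, ∑ s : ι → Fin (finrank 𝕜 X), ∑ τ : Equiv.Perm ι,
        ((Equiv.Perm.sign σ : ℤ) : 𝕜) * ((Equiv.Perm.sign τ : ℤ) : 𝕜) *
          ∏ k, (inner 𝕜 (u (σ k)) (b (s k)) * inner 𝕜 (b (s k)) (v (τ k))) = G.det := by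
      intro σ
      rw [Finset.sum_comm]
      have h3 : ∀ τ : Equiv.Perm ι, ∑ s : ι → Fin (finrank 𝕜 X),
          ((Equiv.Perm.sign σ : ℤ) : 𝕜) * ((Equiv.Perm.sign τ : ℤ) : 𝕜) *
            ∏ k, (inner 𝕜 (u (σ k)) (b (s k)) * inner 𝕜 (b (s k)) (v (τ k))) =
          ((Equiv.Perm.sign σ : ℤ) : 𝕜) *
            (((Equiv.Perm.sign τ : ℤ) : 𝕜) * ∏ k, inner 𝕜 (u (σ k)) (v (τ k))) := by
        intro τ
        rw [← Finset.mul_sum, mul_assoc]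
        congr 2
        rw [← Fintype.prod_sum fun k m => inner 𝕜 (u (σ k)) (b m) * inner 𝕜 (b m) (v (τ k))]
        exact Finset.prod_congr rfl fun k _ => b.sum_inner_mul_inner _ _
      rw [Finset.sum_congr rfl fun τ _ => h3 τ, ← Finset.mul_sum]
      have h4 := Matrix.det_apply' (G.submatrix σ id)ᵀ
      rw [Matrix.det_transpose, Matrix.det_permute] at h4
      simp only [Matrix.transpose_apply, Matrix.submatrix_apply, id, hG, Matrix.of_apply] at h4
      rw [← h4, ← mul_assoc]
      rcases Int.units_eq_one_or (Equiv.Perm.sign σ) with h | h <;> simp [h, hG]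
    rw [Finset.sum_congr rfl fun σ _ => h2 σ]
    simp [Fintype.card_perm]
  have hf : (0 : ℝ) < (Fintype.card ι).factorial := by positivity
  have hsq : (((√((Fintype.card ι).factorial : ℝ))⁻¹ : ℝ) : 𝕜) *
      (((√((Fintype.card ι).factorial : ℝ))⁻¹ : ℝ) : 𝕜) * ((Fintype.card ι).factorial : 𝕜) = 1 := by
    have : (√((Fintype.card ι).factorial : ℝ))⁻¹ * (√((Fintype.card ι).factorial : ℝ))⁻¹ *
        ((Fintype.card ι).factorial : ℝ) = 1 := by
      rw [← mul_inv, Real.mul_self_sqrt hf.le, inv_mul_cancel₀ hf.ne']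
    exact_mod_cast congrArg (RCLike.ofReal (K := 𝕜)) this
  rw [PiLp.inner_apply]
  have h5 : ∀ s, inner 𝕜 (blade 𝕜 u s) (blade 𝕜 v s) =
      (((√((Fintype.card ι).factorial : ℝ))⁻¹ : ℝ) : 𝕜) *
        (((√((Fintype.card ι).factorial : ℝ))⁻¹ : ℝ) : 𝕜) *
      ((starRingEnd 𝕜) (Matrix.of fun i k => inner 𝕜 (b (s k)) (u i)).det *
        (Matrix.of fun i k => inner 𝕜 (b (s k)) (v i)).det) := by
    intro s
    simp only [blade, RCLike.inner_apply, map_mul, RCLike.conj_ofReal]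
    ring
  rw [Finset.sum_congr rfl fun s _ => h5 s, ← Finset.mul_sum, hsum, ← mul_assoc, hsq, one_mul]

theorem norm_blade_sq (v : ι → X) :
    ((‖blade 𝕜 v‖ ^ 2 : ℝ) : 𝕜) = (Matrix.gram 𝕜 v).det := by
  have h := inner_self_eq_norm_sq_to_K (𝕜 := 𝕜) (blade 𝕜 v)
  rw [inner_blade] at h
  push_cast
  exact h.symm

theorem norm_blade_sq' (v : ι → X) :
    ‖blade 𝕜 v‖ ^ 2 = RCLike.re (Matrix.gram 𝕜 v).det := by
  rw [← norm_blade_sq, RCLike.ofReal_re]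

theorem norm_blade_of_orthonormal {v : ι → X} (hv : Orthonormal 𝕜 v) : ‖blade 𝕜 v‖ = 1 := by
  have h := norm_blade_sq' (𝕜 := 𝕜) v
  rw [Matrix.gram_eq_one_iff_orthonormal.mpr hv, Matrix.det_one, RCLike.one_re] at h
  exact (pow_eq_one_iff_of_nonneg (norm_nonneg _) two_ne_zero).mp h

theorem blade_update_add (v : ι → X) (i : ι) (x y : X) :
    blade 𝕜 (Function.update v i (x + y)) =
      blade 𝕜 (Function.update v i x) + blade 𝕜 (Function.update v i y) := by
  have h : ∀ (s : ι → Fin (finrank 𝕜 X)) (z : X), (Matrix.of fun j k =>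
      inner 𝕜 (stdOrthonormalBasis 𝕜 X (s k)) (Function.update v i z j)) =
      (Matrix.of fun j k => inner 𝕜 (stdOrthonormalBasis 𝕜 X (s k)) (v j)).updateRow i
        fun k => inner 𝕜 (stdOrthonormalBasis 𝕜 X (s k)) z := by
    intro s z
    ext j k
    by_cases hj : j = i
    · subst hj; simp
    · simp [hj]
  ext s
  simp only [blade, PiLp.add_apply, h, inner_add_right]
  rw [← mul_add]
  congr 1
  exact Matrix.det_updateRow_add _ _ _ _

theorem blade_update_smul (v : ι → X) (i : ι) (c : 𝕜) (x : X) :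
    blade 𝕜 (Function.update v i (c • x)) = c • blade 𝕜 (Function.update v i x) := by
  have h : ∀ (s : ι → Fin (finrank 𝕜 X)) (z : X), (Matrix.of fun j k =>
      inner 𝕜 (stdOrthonormalBasis 𝕜 X (s k)) (Function.update v i z j)) =
      (Matrix.of fun j k => inner 𝕜 (stdOrthonormalBasis 𝕜 X (s k)) (v j)).updateRow i
        fun k => inner 𝕜 (stdOrthonormalBasis 𝕜 X (s k)) z := by
    intro s z
    ext j k
    by_cases hj : j = i
    · subst hj; simp
    · simp [hj]
  ext s
  simp only [blade, PiLp.smul_apply, h, inner_smul_right, smul_eq_mul]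
  rw [mul_left_comm]
  congr 1
  exact Matrix.det_updateRow_smul _ _ _ _

/-- A vector orthogonal to the span of `h` is orthogonal to the span of `g`, if the two
Plücker vectors are proportional. -/
theorem inner_eq_zero_of_blade_eq_smul {g h : ι → X} {β : 𝕜} (hβ : β ≠ 0)
    (hg : blade 𝕜 g ≠ 0) (hgh : blade 𝕜 h = β • blade 𝕜 g) {c : X}
    (hc : ∀ i, inner 𝕜 c (h i) = 0) (j : ι) : inner 𝕜 c (g j) = 0 := by
  set M := Matrix.gram 𝕜 g with hM
  have hdet : M.det ≠ 0 := by
    rw [hM, ← norm_blade_sq]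
    have : ‖blade 𝕜 g‖ ^ 2 ≠ 0 := pow_ne_zero 2 (norm_ne_zero_iff.mpr hg)
    exact_mod_cast this
  set r : ι → 𝕜 := fun l => inner 𝕜 c (g l) with hr
  -- all minors of `c` against `g` vanish, so Cramer's rule kills the row `r`
  have hcr : Matrix.cramer Mᵀ r = 0 := by
    ext i
    rw [Matrix.cramer_transpose_apply]
    have h1 : M.updateRow i r =
        Matrix.of fun k l => inner 𝕜 (Function.update g i c k) (g l) := by
      ext k l
      by_cases hk : k = i
      · subst hk; simp [hr]
      · simp [hk, hM]
    have h2 : inner 𝕜 (blade 𝕜 (Function.update g i c)) (blade 𝕜 h) = 0 := by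
      rw [inner_blade]
      refine Matrix.det_eq_zero_of_row_eq_zero i fun l => ?_
      simp [hc]
    rw [hgh, inner_smul_right, inner_blade] at h2
    rw [h1]
    exact (mul_eq_zero.mp h2).resolve_left hβ
  have h3 := Matrix.mulVec_cramer Mᵀ r
  rw [hcr, Matrix.mulVec_zero, Matrix.det_transpose] at h3
  have h4 := congrFun h3 j
  simp only [Pi.zero_apply, Pi.smul_apply, smul_eq_mul] at h4
  exact (mul_eq_zero.mp h4.symm).resolve_left hdet

theorem span_range_eq_of_blade_eq_smul {g h : ι → X} {β : 𝕜} (hβ : β ≠ 0)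
    (hg : blade 𝕜 g ≠ 0) (hgh : blade 𝕜 h = β • blade 𝕜 g) :
    Submodule.span 𝕜 (Set.range g) = Submodule.span 𝕜 (Set.range h) := by
  have key : ∀ {g h : ι → X} {β : 𝕜}, β ≠ 0 → blade 𝕜 g ≠ 0 → blade 𝕜 h = β • blade 𝕜 g →
      Submodule.span 𝕜 (Set.range g) ≤ Submodule.span 𝕜 (Set.range h) := by
    intro g h β hβ hg hgh
    rw [Submodule.span_le]
    rintro _ ⟨j, rfl⟩
    rw [SetLike.mem_coe, ← Submodule.orthogonal_orthogonal (Submodule.span 𝕜 (Set.range h)),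
      Submodule.mem_orthogonal]
    intro c hc
    refine inner_eq_zero_of_blade_eq_smul hβ hg hgh (fun i => ?_) j
    exact Submodule.inner_left_of_mem_orthogonal (Submodule.subset_span (Set.mem_range_self i)) hc
  refine le_antisymm (key hβ hg hgh) (key (inv_ne_zero hβ) ?_ ?_)
  · rw [hgh]
    exact smul_ne_zero hβ hg
  · rw [hgh, inv_smul_smul₀ hβ]

end Blades

section GrassmannCosine

open scoped Matrix ComplexOrder

variable {𝕜 X : Type*} [RCLike 𝕜] [NormedAddCommGroup X] [InnerProductSpace 𝕜 X]
  [FiniteDimensional 𝕜 X]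
variable {ι κ : Type*} [Fintype ι] [DecidableEq ι] [Fintype κ] [DecidableEq κ]

/-! ### The cosine of the Grassmann angle -/

/-- The volume contraction factor of the orthogonal projection `V → W`. -/
noncomputable def grassmannCos (V W : Submodule 𝕜 X) : ℝ :=
  ((W.orthogonalProjectionOnto : X →ₗ[𝕜] W) ∘ₗ V.subtype).normDet

theorem grassmannCos_nonneg (V W : Submodule 𝕜 X) : 0 ≤ grassmannCos V W :=
  LinearMap.normDet_nonneg _

theorem finrank_le_of_grassmannCos_ne_zero {V W : Submodule 𝕜 X} (h : grassmannCos V W ≠ 0) :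
    finrank 𝕜 V ≤ finrank 𝕜 W := by
  rw [grassmannCos, Ne, LinearMap.normDet_eq_zero_iff_rank_range_ne, not_not] at h
  exact h ▸ Submodule.finrank_le _

theorem grassmannAngle_eq_arccos (V W : Submodule 𝕜 X) :
    grassmannAngle V W = Real.arccos (grassmannCos V W) := by
  unfold grassmannAngle
  split_ifs with h
  · obtain ⟨e, f, hs⟩ := (exists_isPrincipalSystem V W).choose_spec
    rw [grassmannCos, ← hs.prod_cos_eq_normDet h]
    rfl
  · have h0 : grassmannCos V W = 0 :=
      not_not.mp fun h0 => h (finrank_le_of_grassmannCos_ne_zero h0)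
    rw [h0, Real.arccos_zero]

/-- The Grassmann cosine is the norm of the Plücker vector of a projected orthonormal basis. -/
theorem grassmannCos_eq_norm_blade {V : Submodule 𝕜 X} (W : Submodule 𝕜 X) {e : ι → X}
    (he : Orthonormal 𝕜 e) (hV : Submodule.span 𝕜 (Set.range e) = V) :
    grassmannCos V W = ‖blade 𝕜 fun i => W.starProjection (e i)‖ := by
  have hmem : ∀ i, e i ∈ V := fun i => hV ▸ Submodule.subset_span (Set.mem_range_self i)
  have hon : Orthonormal 𝕜 (fun i => (⟨e i, hmem i⟩ : V)) := by
    rw [orthonormal_iff_ite] at he ⊢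
    exact he
  have hsp : ⊤ ≤ Submodule.span 𝕜 (Set.range fun i => (⟨e i, hmem i⟩ : V)) := by
    intro x _
    have h1 : (x : X) ∈ Submodule.span 𝕜 (Set.range e) := hV ▸ x.2
    have h2 : Set.range e = V.subtype '' Set.range fun i => (⟨e i, hmem i⟩ : V) := by
      rw [← Set.range_comp]
      rfl
    rw [h2, ← Submodule.map_span] at h1
    obtain ⟨y, hy, hyx⟩ := h1
    rwa [← Subtype.ext hyx]
  have h := LinearMap.normDet_sq_eq_det_gram
    ((W.orthogonalProjectionOnto : X →ₗ[𝕜] W) ∘ₗ V.subtype) (OrthonormalBasis.mk hon hsp)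
  have hg : (Matrix.gram 𝕜 fun i => ((W.orthogonalProjectionOnto : X →ₗ[𝕜] W) ∘ₗ V.subtype)
      (OrthonormalBasis.mk hon hsp i)) = Matrix.gram 𝕜 fun i => W.starProjection (e i) := by
    ext i j
    have h1 : inner 𝕜 (W.starProjection (e i)) (W.starProjection (e j)) =
        inner 𝕜 (W.starProjection (e i)) (e j) := by
      rw [← Submodule.inner_starProjection_left_eq_right,
        Submodule.starProjection_eq_self_iff.mpr (W.starProjection_apply_mem _)]
    simp [Matrix.gram_apply, h1]
  rw [hg, ← norm_blade_sq] at h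
  have h' : grassmannCos V W ^ 2 = ‖blade 𝕜 fun i => W.starProjection (e i)‖ ^ 2 := by
    exact_mod_cast h
  exact (sq_eq_sq₀ (grassmannCos_nonneg _ _) (norm_nonneg _)).mp h'

omit [FiniteDimensional 𝕜 X] [DecidableEq ι] in
theorem OrthonormalBasis.span_range_coe {V : Submodule 𝕜 X} (b : OrthonormalBasis ι 𝕜 V) :
    Submodule.span 𝕜 (Set.range fun i => (b i : X)) = V := by
  have h := congrArg (Submodule.map V.subtype) b.toBasis.span_eq
  rw [Submodule.map_span, ← Set.range_comp, Submodule.map_top, Submodule.range_subtype] at h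
  convert h using 3
  ext i
  simp

theorem exists_orthonormal_span_eq (V : Submodule 𝕜 X) :
    ∃ e : Fin (finrank 𝕜 V) → X, Orthonormal 𝕜 e ∧ Submodule.span 𝕜 (Set.range e) = V :=
  ⟨fun i => (stdOrthonormalBasis 𝕜 V i : X),
    (stdOrthonormalBasis 𝕜 V).orthonormal.comp_linearIsometry V.subtypeₗᵢ,
    (stdOrthonormalBasis 𝕜 V).span_range_coe⟩

omit [Fintype ι] [DecidableEq ι] in
theorem gram_starProjection_diag_le {f : ι → X} (hf : Orthonormal 𝕜 f) (W : Submodule 𝕜 X)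
    (i : ι) : RCLike.re (Matrix.gram 𝕜 (fun i => W.starProjection (f i)) i i) ≤ 1 := by
  rw [Matrix.gram_apply, inner_self_eq_norm_sq, sq_le_one_iff₀ (norm_nonneg _), ← hf.1 i]
  exact W.norm_starProjection_apply_le _

theorem mem_of_one_le_gram_diag {x : X} (hx : ‖x‖ = 1) (W : Submodule 𝕜 X)
    (h : 1 ≤ RCLike.re (inner 𝕜 (W.starProjection x) (W.starProjection x))) : x ∈ W := by
  rw [inner_self_eq_norm_sq, one_le_sq_iff₀ (norm_nonneg _), ← hx] at h
  exact W.mem_iff_norm_starProjection x |>.mpr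
    (le_antisymm (W.norm_starProjection_apply_le _) h)

theorem grassmannCos_le_one (V W : Submodule 𝕜 X) : grassmannCos V W ≤ 1 := by
  obtain ⟨e, he, hV⟩ := exists_orthonormal_span_eq V
  have h := (Matrix.posSemidef_gram 𝕜 fun i => W.starProjection (e i)).re_det_le_one
    (gram_starProjection_diag_le he W)
  rw [← norm_blade_sq', ← grassmannCos_eq_norm_blade W he hV] at h
  exact (sq_le_one_iff₀ (grassmannCos_nonneg _ _)).mp h.1

theorem grassmannCos_eq_one_iff {V W : Submodule 𝕜 X} : grassmannCos V W = 1 ↔ V ≤ W := by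
  obtain ⟨e, he, hV⟩ := exists_orthonormal_span_eq V
  have h := (Matrix.posSemidef_gram 𝕜 fun i => W.starProjection (e i)).re_det_le_one
    (gram_starProjection_diag_le he W)
  rw [← norm_blade_sq', ← grassmannCos_eq_norm_blade W he hV] at h
  constructor
  · intro h1
    rw [← hV, Submodule.span_le]
    rintro _ ⟨i, rfl⟩
    exact mem_of_one_le_gram_diag (he.1 i) W (h.2 (by rw [h1, one_pow]) i).ge
  · intro h1
    rw [grassmannCos_eq_norm_blade W he hV, ← norm_blade_of_orthonormal he]
    congr 2
    ext i
    exact Submodule.starProjection_eq_self_iff.mpr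
      (h1 (hV ▸ Submodule.subset_span (Set.mem_range_self i)))

theorem grassmannCos_eq_zero_iff {V W : Submodule 𝕜 X} :
    grassmannCos V W = 0 ↔ PartiallyOrthogonal V W := by
  rw [grassmannCos, LinearMap.normDet_eq_zero_iff_ker_ne_bot, Submodule.ne_bot_iff]
  have hmem : ∀ v : X, W.orthogonalProjectionOnto v = 0 ↔ ∀ w ∈ W, inner 𝕜 v w = 0 := by
    intro v
    rw [Submodule.orthogonalProjectionOnto_eq_zero_iff, Submodule.mem_orthogonal']
  constructor
  · rintro ⟨v, hv, hv0⟩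
    exact ⟨v, v.2, by simpa using hv0, (hmem v).mp (by simpa using hv)⟩
  · rintro ⟨v, hv, hv0, hw⟩
    refine ⟨⟨v, hv⟩, ?_, by simpa using hv0⟩
    simpa using (hmem v).mpr hw

omit [FiniteDimensional 𝕜 X] in
theorem PartiallyOrthogonal.mono_left {U V W : Submodule 𝕜 X} (h : PartiallyOrthogonal U W)
    (hUV : U ≤ V) : PartiallyOrthogonal V W := by
  obtain ⟨v, hv, h⟩ := h
  exact ⟨v, hUV hv, h⟩

omit [FiniteDimensional 𝕜 X] in
theorem PartiallyOrthogonal.mono_right {U V W : Submodule 𝕜 X} (h : PartiallyOrthogonal U W)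
    (hVW : V ≤ W) : PartiallyOrthogonal U V := by
  obtain ⟨v, hv, hv0, h⟩ := h
  exact ⟨v, hv, hv0, fun w hw => h w (hVW hw)⟩

theorem cos_grassmannAngle (V W : Submodule 𝕜 X) :
    Real.cos (grassmannAngle V W) = grassmannCos V W := by
  rw [grassmannAngle_eq_arccos, Real.cos_arccos (by linarith [grassmannCos_nonneg V W])
    (grassmannCos_le_one V W)]

theorem grassmannAngle_nonneg (V W : Submodule 𝕜 X) : 0 ≤ grassmannAngle V W := by
  rw [grassmannAngle_eq_arccos]
  exact Real.arccos_nonneg _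

theorem grassmannAngle_le_pi_div_two (V W : Submodule 𝕜 X) :
    grassmannAngle V W ≤ Real.pi / 2 := by
  rw [grassmannAngle_eq_arccos]
  exact Real.arccos_le_pi_div_two.mpr (grassmannCos_nonneg _ _)

theorem grassmannAngle_eq_zero_iff {V W : Submodule 𝕜 X} : grassmannAngle V W = 0 ↔ V ≤ W := by
  rw [grassmannAngle_eq_arccos, Real.arccos_eq_zero, ← grassmannCos_eq_one_iff]
  exact ⟨fun h => le_antisymm (grassmannCos_le_one _ _) h, fun h => h.ge⟩

theorem grassmannAngle_eq_pi_div_two_iff {V W : Submodule 𝕜 X} :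
    grassmannAngle V W = Real.pi / 2 ↔ PartiallyOrthogonal V W := by
  rw [grassmannAngle_eq_arccos, Real.arccos_eq_pi_div_two, grassmannCos_eq_zero_iff]

/-! ### Enlarging the first subspace -/

/-- Enlarging an orthonormal family shrinks the volume of its projection to `W`, and keeps it only
if the new vectors lie in `W`. The Gram matrix of the projections splits into blocks, and the Schur
complement of the first one has diagonal entries `≤ 1`. -/
theorem norm_blade_starProjection_sum_le {f : ι ⊕ κ → X} (hf : Orthonormal 𝕜 f)
    (W : Submodule 𝕜 X) (h0 : blade 𝕜 (fun i => W.starProjection (f i)) ≠ 0) :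
    ‖blade 𝕜 fun i => W.starProjection (f i)‖ ≤
        ‖blade 𝕜 fun i => W.starProjection (f (Sum.inl i))‖ ∧
      (‖blade 𝕜 fun i => W.starProjection (f (Sum.inl i))‖ ≤
        ‖blade 𝕜 fun i => W.starProjection (f i)‖ → ∀ k, f (Sum.inr k) ∈ W) := by
  set g : ι ⊕ κ → X := fun i => W.starProjection (f i) with hg
  set G := Matrix.gram 𝕜 g with hG
  have hdet : G.det ≠ 0 := by
    rw [hG, ← norm_blade_sq]
    exact_mod_cast pow_ne_zero 2 (norm_ne_zero_iff.mpr h0)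
  set A := Matrix.gram 𝕜 fun i => g (Sum.inl i) with hA
  set B : Matrix ι κ 𝕜 := Matrix.of fun i k => inner 𝕜 (g (Sum.inl i)) (g (Sum.inr k)) with hB
  set D := Matrix.gram 𝕜 fun k => g (Sum.inr k) with hD
  have hblock : G = Matrix.fromBlocks A B Bᴴ D := by
    ext (i | i) (j | j) <;>
      simp [hG, hA, hB, hD, Matrix.gram_apply]
  have hApos : A.PosDef := by
    have hli : LinearIndependent 𝕜 g := Matrix.linearIndependent_of_det_gram_ne_zero hdet
    exact Matrix.posDef_gram_of_linearIndependent (hli.comp _ Sum.inl_injective)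
  have : Invertible A := hApos.isUnit.invertible
  have hS : (D - Bᴴ * A⁻¹ * B).PosSemidef := by
    rw [← Matrix.PosDef.fromBlocks₁₁ B D hApos, ← hblock]
    exact Matrix.posSemidef_gram 𝕜 g
  have hprod : G.det = A.det * (D - Bᴴ * A⁻¹ * B).det := by
    rw [hblock, Matrix.det_fromBlocks₁₁, Matrix.invOf_eq_nonsing_inv]
  have hQ : (Bᴴ * A⁻¹ * B).PosSemidef := hApos.inv.posSemidef.conjTranspose_mul_mul_same B
  have hdiag : ∀ k, RCLike.re ((D - Bᴴ * A⁻¹ * B) k k) ≤ RCLike.re (D k k) := by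
    intro k
    have := (RCLike.nonneg_iff.mp (hQ.diag_nonneg (i := k))).1
    rw [Matrix.sub_apply, map_sub]
    linarith
  have hD1 : ∀ k, RCLike.re (D k k) ≤ 1 :=
    gram_starProjection_diag_le (hf.comp _ Sum.inr_injective) W
  obtain ⟨h1, h2⟩ := hS.re_det_le_one fun k => (hdiag k).trans (hD1 k)
  have hreal : ‖blade 𝕜 g‖ ^ 2 =
      ‖blade 𝕜 fun i => g (Sum.inl i)‖ ^ 2 * RCLike.re (D - Bᴴ * A⁻¹ * B).det := by
    rw [norm_blade_sq', ← hG, hprod, hA, ← norm_blade_sq, RCLike.re_ofReal_mul]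
  have hApos' : 0 < ‖blade 𝕜 fun i => g (Sum.inl i)‖ ^ 2 := by
    refine lt_of_le_of_ne (sq_nonneg _) fun h => ?_
    rw [← h, zero_mul] at hreal
    exact h0 (norm_eq_zero.mp (pow_eq_zero_iff two_ne_zero |>.mp hreal))
  constructor
  · rw [← sq_le_sq₀ (norm_nonneg _) (norm_nonneg _), hreal]
    exact mul_le_of_le_one_right hApos'.le h1
  · intro hle k
    rw [← sq_le_sq₀ (norm_nonneg _) (norm_nonneg _), hreal] at hle
    have h3 := h2 (le_of_mul_le_mul_left (by rwa [mul_one]) hApos') k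
    exact mem_of_one_le_gram_diag (hf.1 _) W (h3.ge.trans (hdiag k))

omit [FiniteDimensional 𝕜 X] [Fintype ι] [Fintype κ] in
theorem Orthonormal.sumElim_of_isOrtho {U V : Submodule 𝕜 X} (hUV : U ⟂ V) {e : ι → X}
    {f : κ → X} (he : Orthonormal 𝕜 e) (hf : Orthonormal 𝕜 f) (heU : ∀ i, e i ∈ U)
    (hfV : ∀ i, f i ∈ V) : Orthonormal 𝕜 (Sum.elim e f) := by
  rw [orthonormal_iff_ite] at he hf ⊢
  rintro (i | i) (j | j)
  · simpa using he i j
  · simpa using hUV.inner_eq (heU i) (hfV j)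
  · simpa using hUV.symm.inner_eq (hfV i) (heU j)
  · simpa using hf i j

omit [FiniteDimensional 𝕜 X] [Fintype ι] [DecidableEq ι] [Fintype κ]
  [DecidableEq κ] in
theorem span_range_sumElim {U V : Submodule 𝕜 X} {e : ι → X} {f : κ → X}
    (he : Submodule.span 𝕜 (Set.range e) = U) (hf : Submodule.span 𝕜 (Set.range f) = V) :
    Submodule.span 𝕜 (Set.range (Sum.elim e f)) = U ⊔ V := by
  rw [Set.Sum.elim_range, Submodule.span_union, he, hf]

omit [FiniteDimensional 𝕜 X] [Fintype ι] [DecidableEq ι] in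
theorem mem_of_span_range_eq {U : Submodule 𝕜 X} {e : ι → X}
    (he : Submodule.span 𝕜 (Set.range e) = U) (i : ι) : e i ∈ U :=
  he ▸ Submodule.subset_span (Set.mem_range_self i)

omit [FiniteDimensional 𝕜 X] in
theorem isOrtho_orthogonal_inf (U V : Submodule 𝕜 X) : U ⟂ Uᗮ ⊓ V :=
  (Submodule.isOrtho_orthogonal_right U).mono_right inf_le_left

/-- Enlarging the first subspace cannot raise the cosine; a nonzero cosine stays the same only if the
new directions lie in `W`. -/
theorem grassmannCos_le_of_le {U V : Submodule 𝕜 X} (W : Submodule 𝕜 X) (hUV : U ≤ V) :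
    grassmannCos V W ≤ grassmannCos U W ∧
      (grassmannCos V W ≠ 0 → grassmannCos U W ≤ grassmannCos V W → Uᗮ ⊓ V ≤ W) := by
  obtain ⟨e, he, heU⟩ := exists_orthonormal_span_eq U
  obtain ⟨f, hf, hfV⟩ := exists_orthonormal_span_eq (Uᗮ ⊓ V)
  have hon := Orthonormal.sumElim_of_isOrtho (isOrtho_orthogonal_inf U V) he hf
    (mem_of_span_range_eq heU) (mem_of_span_range_eq hfV)
  have hsp := span_range_sumElim heU hfV
  rw [Submodule.sup_orthogonal_inf_of_hasOrthogonalProjection hUV] at hsp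
  by_cases h0 : grassmannCos V W = 0
  · exact ⟨h0 ▸ grassmannCos_nonneg _ _, fun h => absurd h0 h⟩
  · have h1 := h0
    rw [grassmannCos_eq_norm_blade W hon hsp, norm_eq_zero] at h1
    have h2 := norm_blade_starProjection_sum_le hon W h1
    rw [← grassmannCos_eq_norm_blade W hon hsp] at h2
    simp only [Sum.elim_inl, Sum.elim_inr] at h2
    rw [← grassmannCos_eq_norm_blade W he heU] at h2
    refine ⟨h2.1, fun _ h3 => ?_⟩
    rw [← hfV, Submodule.span_le]
    rintro _ ⟨k, rfl⟩
    exact h2.2 h3 k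

theorem grassmannCos_sup_of_isOrtho {U B : Submodule 𝕜 X} (W : Submodule 𝕜 X) (hUB : U ⟂ B)
    (hBW : B ≤ W) : grassmannCos (U ⊔ B) W = grassmannCos U W := by
  obtain ⟨e, he, heU⟩ := exists_orthonormal_span_eq U
  obtain ⟨f, hf, hfB⟩ := exists_orthonormal_span_eq B
  have hon := Orthonormal.sumElim_of_isOrtho hUB he hf
    (mem_of_span_range_eq heU) (mem_of_span_range_eq hfB)
  have hsp := span_range_sumElim heU hfB
  rw [grassmannCos_eq_norm_blade W hon hsp, grassmannCos_eq_norm_blade W he heU,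
    ← sq_eq_sq₀ (norm_nonneg _) (norm_nonneg _), norm_blade_sq', norm_blade_sq']
  have hfP : ∀ k, W.starProjection (f k) = f k := fun k =>
    Submodule.starProjection_eq_self_iff.mpr (hBW (mem_of_span_range_eq hfB k))
  have horth : ∀ i k, inner 𝕜 (W.starProjection (e i)) (f k) = 0 := fun i k => by
    rw [Submodule.inner_starProjection_left_eq_right, hfP]
    exact hUB.inner_eq (mem_of_span_range_eq heU i) (mem_of_span_range_eq hfB k)
  have hblock : (Matrix.gram 𝕜 fun i => W.starProjection (Sum.elim e f i)) =
      Matrix.fromBlocks (Matrix.gram 𝕜 fun i => W.starProjection (e i)) 0 0 1 := by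
    ext (i | i) (j | j)
    · simp [Matrix.gram_apply]
    · simp [Matrix.gram_apply, hfP, horth]
    · rw [Matrix.gram_apply, ← inner_conj_symm]
      simp [hfP, horth]
    · simp [Matrix.gram_apply, hfP, orthonormal_iff_ite.mp hf, Matrix.one_apply]
  rw [hblock, Matrix.det_fromBlocks_zero₂₁, Matrix.det_one, mul_one]

/-- Under `h` the projections to `V` and to `W` agree on `U`. -/
theorem grassmannCos_congr_of_le {U V W : Submodule 𝕜 X} (hVW : V ≤ W)
    (h : U.map (W.starProjection : X →ₗ[𝕜] X) ≤ V) : grassmannCos U V = grassmannCos U W := by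
  obtain ⟨e, he, heU⟩ := exists_orthonormal_span_eq U
  rw [grassmannCos_eq_norm_blade W he heU, grassmannCos_eq_norm_blade V he heU]
  congr 2
  ext i
  refine (Submodule.eq_starProjection_of_mem_of_inner_eq_zero
    (h (Submodule.mem_map_of_mem (mem_of_span_range_eq heU i))) fun w hw => ?_)
  exact Submodule.starProjection_inner_eq_zero _ _ (hVW hw)

end GrassmannCosine

section TriangleEquality

variable {𝕜 X : Type*} [RCLike 𝕜] [NormedAddCommGroup X] [InnerProductSpace 𝕜 X]
variable {ι : Type*} [Fintype ι] [DecidableEq ι]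

/-! ### Euclidean angles -/

/-- The triangle inequality for angles, in terms of cosines, with its equality case. -/
theorem cos_add_le_re_inner {x y z : X} (hx : ‖x‖ = 1) (hy : ‖y‖ = 1) (hz : ‖z‖ = 1) {a b : ℝ}
    (ha : 0 ≤ a) (hb : 0 ≤ b) (hab : a + b < Real.pi)
    (hxy : RCLike.re (inner 𝕜 x y) = Real.cos a) (hyz : RCLike.re (inner 𝕜 y z) = Real.cos b) :
    Real.cos (a + b) ≤ RCLike.re (inner 𝕜 x z) ∧
      (RCLike.re (inner 𝕜 x z) ≤ Real.cos (a + b) →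
        ∃ α β : ℝ, 0 ≤ α ∧ 0 ≤ β ∧ y = (α : 𝕜) • x + (β : 𝕜) • z) := by
  let _ : InnerProductSpace ℝ X := InnerProductSpace.rclikeToReal 𝕜 X
  have hin : ∀ p q : X, inner ℝ p q = RCLike.re (inner 𝕜 p q) := fun _ _ => rfl
  have hang : ∀ {p q : X} {t : ℝ}, ‖p‖ = 1 → ‖q‖ = 1 → 0 ≤ t → t ≤ Real.pi →
      RCLike.re (inner 𝕜 p q) = Real.cos t → InnerProductGeometry.angle p q = t := by
    intro p q t hp hq h0 h1 h
    rw [InnerProductGeometry.angle, hin, h, hp, hq, mul_one, div_one, Real.arccos_cos h0 h1]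
  have h1 := hang hx hy ha (by linarith) hxy
  have h2 := hang hy hz hb (by linarith) hyz
  have h3 : Real.cos (InnerProductGeometry.angle x z) = RCLike.re (inner 𝕜 x z) := by
    rw [InnerProductGeometry.cos_angle, hin, hx, hz, mul_one, div_one]
  have hle := InnerProductGeometry.angle_le_angle_add_angle x y z
  rw [h1, h2] at hle
  have hcos : Real.cos (a + b) ≤ RCLike.re (inner 𝕜 x z) := by
    rw [← h3]
    exact Real.cos_le_cos_of_nonneg_of_le_pi (InnerProductGeometry.angle_nonneg _ _) hab.le hle
  refine ⟨hcos, fun h => ?_⟩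
  have h4 := hang hx hz (by linarith) hab.le (le_antisymm h hcos)
  have hy0 : y ≠ 0 := fun h => by simp [h] at hy
  have h5 := (InnerProductGeometry.angle_eq_angle_add_angle_iff (x := x) (z := z) hy0).mp
    (by rw [h1, h2, h4])
  rw [h4] at h5
  have h6 := h5.resolve_left hab.ne
  obtain ⟨α, β, h7⟩ := Submodule.mem_span_pair.mp h6
  refine ⟨α, β, α.2, β.2, ?_⟩
  rw [← h7]
  rfl

theorem euclideanAngle_eq_add {u w : X} {a b : ℝ} (ha : 0 ≤ a) (hb : 0 ≤ b) (hu : u ≠ 0)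
    (hv : (a : 𝕜) • u + (b : 𝕜) • w ≠ 0) :
    euclideanAngle 𝕜 u w = euclideanAngle 𝕜 u ((a : 𝕜) • u + (b : 𝕜) • w) +
      euclideanAngle 𝕜 ((a : 𝕜) • u + (b : 𝕜) • w) w := by
  let _ : InnerProductSpace ℝ X := InnerProductSpace.rclikeToReal 𝕜 X
  have hang : ∀ {p q : X}, p ≠ 0 → euclideanAngle 𝕜 p q = InnerProductGeometry.angle p q := by
    intro p q hp
    rw [euclideanAngle, if_neg hp]
    rfl
  rw [hang hu, hang hu, hang hv]
  refine InnerProductGeometry.angle_eq_angle_add_add_angle_add_of_mem_span hv ?_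
  rw [Submodule.mem_span_pair]
  exact ⟨⟨a, ha⟩, ⟨b, hb⟩, rfl⟩

/-- Equality case of the Cauchy–Schwarz inequality against a unit vector. -/
theorem eq_smul_of_inner_eq_norm {x y : X} {r : ℝ} (hy : ‖y‖ = 1)
    (hx : ‖x‖ = r) (hxy : inner 𝕜 x y = (r : 𝕜)) : x = (r : 𝕜) • y := by
  rw [← sub_eq_zero, ← norm_eq_zero, ← sq_eq_zero_iff, @norm_sub_sq 𝕜, inner_smul_right, hxy,
    norm_smul, hx, hy, RCLike.norm_ofReal, ← RCLike.ofReal_mul, RCLike.ofReal_re, mul_one, sq_abs]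
  ring

variable [FiniteDimensional 𝕜 X]

/-! ### Lines modulo common directions -/

/-- The condition `hW` says that the part of `W` across `w` is orthogonal to `u`, so that `u` projects
to a multiple of `w`. -/
theorem grassmannCos_span_singleton {u w : X} {W : Submodule 𝕜 X} (hu : u ≠ 0) (hw : w ≠ 0)
    (hwW : w ∈ W) (hW : ∀ x ∈ W, inner 𝕜 w x = 0 → inner 𝕜 u x = 0) :
    grassmannCos (Submodule.span 𝕜 {u}) W = ‖(inner 𝕜 u w : 𝕜)‖ / (‖u‖ * ‖w‖) := by
  have hu' : ‖u‖ ≠ 0 := norm_ne_zero_iff.mpr hu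
  have hw' : ‖w‖ ≠ 0 := norm_ne_zero_iff.mpr hw
  have hw2 : (inner 𝕜 w w : 𝕜) ≠ 0 := inner_self_ne_zero.mpr hw
  set e : Unit → X := fun _ => ((‖u‖⁻¹ : ℝ) : 𝕜) • u with he
  have hon : Orthonormal 𝕜 e := by
    constructor
    · intro i
      simp [he, norm_smul, hu']
    · intro i j hij
      exact absurd (Subsingleton.elim i j) hij
  have hsp : Submodule.span 𝕜 (Set.range e) = Submodule.span 𝕜 {u} := by
    rw [Set.range_const]
    refine Submodule.span_singleton_smul_eq (isUnit_iff_ne_zero.mpr ?_) u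
    exact_mod_cast inv_ne_zero hu'
  have hP : W.starProjection u = ((inner 𝕜 w u : 𝕜) / (inner 𝕜 w w)) • w := by
    refine (Submodule.eq_starProjection_of_mem_of_inner_eq_zero (W.smul_mem _ hwW) ?_)
    intro x hx
    -- split `x ∈ W` into its components along and across `w`
    set y := x - ((inner 𝕜 w x : 𝕜) / (inner 𝕜 w w)) • w with hy
    have hyW : y ∈ W := W.sub_mem hx (W.smul_mem _ hwW)
    have hwy : inner 𝕜 w y = 0 := by
      rw [hy, inner_sub_right, inner_smul_right, div_mul_cancel₀ _ hw2, sub_self]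
    have hx' : x = y + ((inner 𝕜 w x : 𝕜) / (inner 𝕜 w w)) • w := by rw [hy, sub_add_cancel]
    rw [hx', inner_add_right, inner_sub_left, inner_sub_left, inner_smul_left, hwy, hW y hyW hwy,
      inner_smul_left, inner_smul_right, inner_smul_right, map_div₀, inner_conj_symm,
      inner_conj_symm]
    field_simp
    ring
  rw [grassmannCos_eq_norm_blade W hon hsp, ← sq_eq_sq₀ (norm_nonneg _) (by positivity),
    norm_blade_sq', Matrix.det_unique, Matrix.gram_apply, inner_self_eq_norm_sq]
  congr 1
  simp only [he, map_smul, hP, norm_smul, norm_div, inner_self_eq_norm_sq_to_K, norm_pow,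
    RCLike.norm_ofReal, abs_norm, abs_inv]
  rw [norm_inner_symm]
  field_simp

/-- Directions common to both subspaces, and directions of the larger one orthogonal to everything else,
do not affect the angle. -/
theorem grassmannAngle_span_sup {u w : X} (hu : u ≠ 0) (hw : w ≠ 0)
    (him : RCLike.im (inner 𝕜 u w) = 0) (hre : 0 ≤ RCLike.re (inner 𝕜 u w))
    {A B : Submodule 𝕜 X} (hA : A ⟂ Submodule.span 𝕜 {u, w})
    (hB : B ⟂ Submodule.span 𝕜 {u, w}) :
    euclideanAngle 𝕜 u w =
      grassmannAngle (Submodule.span 𝕜 {u} ⊔ A) (Submodule.span 𝕜 {w} ⊔ A ⊔ B) := by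
  have hu2 : u ∈ Submodule.span 𝕜 {u, w} := Submodule.subset_span (by simp)
  have hw2 : w ∈ Submodule.span 𝕜 {u, w} := Submodule.subset_span (by simp)
  have hw0 : (inner 𝕜 w w : 𝕜) ≠ 0 := inner_self_ne_zero.mpr hw
  have hort : Submodule.span 𝕜 {u} ⟂ A := by
    rw [Submodule.isOrtho_iff_inner_eq]
    intro x hx y hy
    obtain ⟨c, rfl⟩ := Submodule.mem_span_singleton.mp hx
    rw [inner_smul_left, hA.symm.inner_eq hu2 hy, mul_zero]
  rw [grassmannAngle_eq_arccos, grassmannCos_sup_of_isOrtho _ hort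
    (le_sup_right.trans le_sup_left), grassmannCos_span_singleton hu hw
    ((le_sup_left.trans le_sup_left : Submodule.span 𝕜 {w} ≤ _)
      (Submodule.mem_span_singleton_self w)), euclideanAngle, if_neg hu]
  · have : ‖(inner 𝕜 u w : 𝕜)‖ = RCLike.re (inner 𝕜 u w) := by
      rw [← RCLike.re_add_im (inner 𝕜 u w : 𝕜), him]
      simp [abs_of_nonneg hre]
    rw [this]
  · intro x hx hwx
    obtain ⟨y, hy, z, hz, rfl⟩ := Submodule.mem_sup.mp hx
    obtain ⟨s, hs, r, hr, rfl⟩ := Submodule.mem_sup.mp hy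
    obtain ⟨c, rfl⟩ := Submodule.mem_span_singleton.mp hs
    rw [inner_add_right, inner_add_right, hA.symm.inner_eq hw2 hr, hB.symm.inner_eq hw2 hz,
      add_zero, add_zero, inner_smul_right] at hwx
    have hc : c = 0 := (mul_eq_zero.mp hwx).resolve_right hw0
    rw [inner_add_right, inner_add_right, hA.symm.inner_eq hu2 hr, hB.symm.inner_eq hu2 hz, hc,
      zero_smul, inner_zero_right, add_zero, add_zero]

end TriangleEquality

section TriangleEqualityCases

variable {𝕜 X : Type*} [RCLike 𝕜] [NormedAddCommGroup X] [InnerProductSpace 𝕜 X]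
  [FiniteDimensional 𝕜 X]
variable {ι : Type*} [Fintype ι] [DecidableEq ι]

/-! ### Sufficiency of the conditions -/

omit [FiniteDimensional 𝕜 X] in
theorem IsAlignedDecomposition.v_ne_zero {U V W : Submodule 𝕜 X} {u v w : X} {a b : ℝ}
    {A B C : Submodule 𝕜 X} (h : IsAlignedDecomposition U V W u v w a b A B C) : v ≠ 0 := by
  intro hv
  have h1 : RCLike.re (inner 𝕜 u v) = a * ‖u‖ ^ 2 + b * RCLike.re (inner 𝕜 u w) := by
    rw [h.v_eq, inner_add_right, inner_smul_right, inner_smul_right, map_add,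
      RCLike.re_ofReal_mul, RCLike.re_ofReal_mul, inner_self_eq_norm_sq]
  rw [hv, inner_zero_right, map_zero] at h1
  have h2 : 0 < a * ‖u‖ ^ 2 :=
    mul_pos h.a_pos (pow_pos (norm_pos_iff.mpr h.u_ne_zero) 2)
  have h3 := mul_nonneg h.b_pos.le h.inner_re
  linarith

theorem IsAlignedDecomposition.euclideanAngle_eq {U V W : Submodule 𝕜 X} {u v w : X} {a b : ℝ}
    {A B C : Submodule 𝕜 X} (h : IsAlignedDecomposition U V W u v w a b A B C) :
    euclideanAngle 𝕜 u v = grassmannAngle U V ∧ euclideanAngle 𝕜 u w = grassmannAngle U W ∧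
      euclideanAngle 𝕜 v w = grassmannAngle V W := by
  have hu : u ∈ Submodule.span 𝕜 {u, w} := Submodule.subset_span (by simp)
  have hw : w ∈ Submodule.span 𝕜 {u, w} := Submodule.subset_span (by simp)
  have hv : v ∈ Submodule.span 𝕜 {u, w} := by
    rw [h.v_eq]
    exact add_mem (Submodule.smul_mem _ _ hu) (Submodule.smul_mem _ _ hw)
  have hpair : ∀ {x y : X}, x ∈ Submodule.span 𝕜 {u, w} → y ∈ Submodule.span 𝕜 {u, w} →
      Submodule.span 𝕜 {x, y} ≤ Submodule.span 𝕜 {u, w} := by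
    intro x y hx hy
    rw [Submodule.span_le]
    rintro z (rfl | rfl)
    exacts [hx, hy]
  have hreal : ∀ x : X, RCLike.im (inner 𝕜 x x) = 0 := fun x => inner_self_im x
  refine ⟨?_, ?_, ?_⟩
  · rw [h.U_eq, h.V_eq]
    refine grassmannAngle_span_sup h.u_ne_zero h.v_ne_zero ?_ ?_
      (h.orthoA.mono_right (hpair hu hv)) (h.orthoB.mono_right (hpair hu hv))
    · rw [h.v_eq, inner_add_right, inner_smul_right, inner_smul_right, map_add,
        RCLike.im_ofReal_mul, RCLike.im_ofReal_mul, hreal, h.inner_im]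
      ring
    · rw [h.v_eq, inner_add_right, inner_smul_right, inner_smul_right, map_add,
        RCLike.re_ofReal_mul, RCLike.re_ofReal_mul]
      exact add_nonneg (mul_nonneg h.a_pos.le inner_self_nonneg)
        (mul_nonneg h.b_pos.le h.inner_re)
  · rw [h.U_eq, h.W_eq, sup_assoc _ B C]
    exact grassmannAngle_span_sup h.u_ne_zero h.w_ne_zero h.inner_im h.inner_re h.orthoA
      (Submodule.isOrtho_sup_left.mpr ⟨h.orthoB, h.orthoC⟩)
  · rw [h.V_eq, h.W_eq, sup_assoc _ A B, sup_assoc _ A B]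
    refine grassmannAngle_span_sup h.v_ne_zero h.w_ne_zero ?_ ?_
      (Submodule.isOrtho_sup_left.mpr ⟨h.orthoA.mono_right (hpair hv hw),
        h.orthoB.mono_right (hpair hv hw)⟩) (h.orthoC.mono_right (hpair hv hw))
    · rw [h.v_eq, inner_add_left, inner_smul_left, inner_smul_left, map_add,
        RCLike.conj_ofReal, RCLike.conj_ofReal,
        RCLike.im_ofReal_mul, RCLike.im_ofReal_mul, hreal, h.inner_im]
      ring
    · rw [h.v_eq, inner_add_left, inner_smul_left, inner_smul_left, map_add,
        RCLike.conj_ofReal, RCLike.conj_ofReal, RCLike.re_ofReal_mul, RCLike.re_ofReal_mul]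
      exact add_nonneg (mul_nonneg h.a_pos.le h.inner_re)
        (mul_nonneg h.b_pos.le inner_self_nonneg)

theorem IsAlignedDecomposition.grassmannAngle_eq_add {U V W : Submodule 𝕜 X} {u v w : X}
    {a b : ℝ} {A B C : Submodule 𝕜 X} (h : IsAlignedDecomposition U V W u v w a b A B C) :
    grassmannAngle U W = grassmannAngle U V + grassmannAngle V W := by
  obtain ⟨h1, h2, h3⟩ := h.euclideanAngle_eq
  have h0 : (a : 𝕜) • u + (b : 𝕜) • w ≠ 0 := fun h4 => h.v_ne_zero (h.v_eq.trans h4)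
  rw [← h1, ← h2, ← h3, h.v_eq]
  exact euclideanAngle_eq_add (𝕜 := 𝕜) h.a_pos.le h.b_pos.le h.u_ne_zero h0

theorem grassmannAngle_eq_add_of_le_left {U V W : Submodule 𝕜 X} (hUV : U ≤ V)
    (h : PartiallyOrthogonal U W ∨ Uᗮ ⊓ V ≤ W) :
    grassmannAngle U W = grassmannAngle U V + grassmannAngle V W := by
  rw [grassmannAngle_eq_zero_iff.mpr hUV, zero_add]
  rcases h with h | h
  · rw [grassmannAngle_eq_pi_div_two_iff.mpr h,
      grassmannAngle_eq_pi_div_two_iff.mpr (h.mono_left hUV)]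
  · have h1 := grassmannCos_sup_of_isOrtho W (isOrtho_orthogonal_inf U V) h
    rw [Submodule.sup_orthogonal_inf_of_hasOrthogonalProjection hUV] at h1
    rw [grassmannAngle_eq_arccos, grassmannAngle_eq_arccos, h1]

theorem grassmannAngle_eq_add_of_le_right {U V W : Submodule 𝕜 X} (hVW : V ≤ W)
    (h : PartiallyOrthogonal U W ∨ U.map (W.starProjection : X →ₗ[𝕜] X) ≤ V) :
    grassmannAngle U W = grassmannAngle U V + grassmannAngle V W := by
  rw [grassmannAngle_eq_zero_iff.mpr hVW, add_zero]
  rcases h with h | h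
  · rw [grassmannAngle_eq_pi_div_two_iff.mpr h,
      grassmannAngle_eq_pi_div_two_iff.mpr (h.mono_right hVW)]
  · rw [grassmannAngle_eq_arccos, grassmannAngle_eq_arccos, grassmannCos_congr_of_le hVW h]

/-! ### Necessity of the conditions -/

/-- Principal bases in the form used below: an orthonormal basis `e` of `U` whose projections to
`V` are multiples of orthonormal vectors `f`. -/
theorem exists_principal_family {U V : Submodule 𝕜 X} (h : finrank 𝕜 U ≤ finrank 𝕜 V) :
    ∃ (e f : Fin (finrank 𝕜 U) → X) (c : Fin (finrank 𝕜 U) → ℝ),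
      Orthonormal 𝕜 e ∧ Submodule.span 𝕜 (Set.range e) = U ∧ Orthonormal 𝕜 f ∧
      (∀ i, f i ∈ V) ∧ (∀ i, 0 ≤ c i) ∧ (∀ i, V.starProjection (e i) = (c i : 𝕜) • f i) ∧
      grassmannCos U V = ∏ i, c i := by
  obtain ⟨θ, e, f, hs⟩ := exists_isPrincipalSystem U V
  refine ⟨fun i => e i, fun i => f (Fin.castLE h i),
    fun i => Real.cos (θ (Fin.cast (min_eq_left h).symm i)),
    e.orthonormal.comp_linearIsometry U.subtypeₗᵢ, e.span_range_coe,
    (f.orthonormal.comp_linearIsometry V.subtypeₗᵢ).comp _ (Fin.castLE_injective h),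
    fun i => (f _).2, fun i => ?_, fun i => ?_, ?_⟩
  · exact Real.cos_nonneg_of_neg_pi_div_two_le_of_le
      (by linarith [hs.nonneg (Fin.cast (min_eq_left h).symm i), Real.pi_pos])
      (hs.le_pi_div_two _)
  · rw [Submodule.starProjection_apply, ← Submodule.coe_smul]
    congr 1
    refine f.repr.injective (PiLp.ext fun j => ?_)
    have h1 : inner 𝕜 (f j : X) (e i : X) =
        inner 𝕜 (f j) (V.orthogonalProjectionOnto (e i : X)) :=
      (Submodule.inner_orthogonalProjectionOnto_eq_of_mem_left (f j) (e i : X)).symm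
    rw [f.repr_apply_apply, f.repr_apply_apply, ← h1, ← inner_conj_symm, hs.inner_eq,
      inner_smul_right, orthonormal_iff_ite.mp f.orthonormal]
    simp only [Fin.ext_iff, Fin.val_castLE]
    by_cases hij : i.val = j.val
    · simp only [hij, dif_pos, if_true, mul_one, RCLike.conj_ofReal]
      congr 3
      exact Fin.ext hij.symm
    · simp [hij, Ne.symm hij]
  · rw [grassmannCos, ← hs.prod_cos_eq_normDet h]
    exact Fintype.prod_equiv (finCongr (min_eq_left h)) _ _ fun i => rfl

/-- If the Plücker vectors satisfy `f = α e + β g`, then at most one of the principal angles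
between `e` and `f` is nonzero. Here `k i` is the component of `e i` orthogonal to `f i`, rescaled so
that `⟪k i, e i⟫ = c i`; exchanging `f i` or `f j` for it annihilates `f` and fixes the product
with `e`, so the three-term relation for `g` reads `(1 - α ∏ c) (-α ∏ c) = (α ∏ c)²`. -/
theorem mul_prod_eq_zero_of_blade_eq_add {e f g k : ι → X} {c : ι → 𝕜} {α β : 𝕜} {i j : ι}
    (hij : i ≠ j) (hff : Orthonormal 𝕜 f)
    (hfe : ∀ m l, inner 𝕜 (f m) (e l) = if m = l then c m else 0)
    (hkf : ∀ m, m = i ∨ m = j → ∀ l, inner 𝕜 (k m) (f l) = 0)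
    (hke : ∀ m, m = i ∨ m = j → ∀ l, inner 𝕜 (k m) (e l) = if m = l then c m else 0)
    (hdet : inner 𝕜 (blade 𝕜 f) (blade 𝕜 g) ≠ 0)
    (hrel : blade 𝕜 f = α • blade 𝕜 e + β • blade 𝕜 g) : α * ∏ m, c m = 0 := by
  set M : Matrix ι ι 𝕜 := Matrix.of fun m l => inner 𝕜 (f m) (g l) with hM
  rw [inner_blade] at hdet
  -- the pairing of the relation with a test family
  have hpair : ∀ t : ι → X, β * (Matrix.of fun m l => inner 𝕜 (t m) (g l)).det =
      (Matrix.of fun m l => inner 𝕜 (t m) (f l)).det -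
        α * (Matrix.of fun m l => inner 𝕜 (t m) (e l)).det := by
    intro t
    rw [← inner_blade, ← inner_blade, ← inner_blade, ← inner_smul_right, ← inner_smul_right,
      ← inner_sub_right, hrel]
    congr 1
    abel
  have hrow : ∀ (t : ι → X) (m : ι) (x : X),
      (Matrix.of fun n l => inner 𝕜 (Function.update t m x n) (g l)) =
        (Matrix.of fun n l => inner 𝕜 (t n) (g l)).updateRow m fun l => inner 𝕜 x (g l) := by
    intro t m x
    ext n l
    by_cases hn : n = m
    · subst hn; simp
    · simp [hn]
  have hzero : ∀ (t : ι → X) (m : ι), (∀ l, inner 𝕜 (t m) (f l) = 0) →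
      (Matrix.of fun m l => inner 𝕜 (t m) (f l)).det = 0 := fun t m h =>
    Matrix.det_eq_zero_of_row_eq_zero m h
  have hdiag : ∀ t : ι → X, (∀ m l, inner 𝕜 (t m) (e l) = if m = l then c m else 0) →
      (Matrix.of fun m l => inner 𝕜 (t m) (e l)).det = ∏ m, c m := by
    intro t h
    rw [← Matrix.det_diagonal]
    congr 1
    ext m l
    rw [Matrix.of_apply, h, Matrix.diagonal_apply]
  have h0 : β * M.det = 1 - α * ∏ m, c m := by
    rw [hM, hpair, hdiag f hfe]
    congr 1
    have : (Matrix.of fun m l => inner 𝕜 (f m) (f l)) = (1 : Matrix ι ι 𝕜) :=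
      Matrix.gram_eq_one_iff_orthonormal.mpr hff
    rw [this, Matrix.det_one]
  have h1 : ∀ m, m = i ∨ m = j →
      β * (M.updateRow m fun l => inner 𝕜 (k m) (g l)).det = -(α * ∏ m, c m) := by
    intro m hm
    rw [hM, ← hrow, hpair, hzero _ m (by simpa using hkf m hm), hdiag, zero_sub]
    intro n l
    by_cases hn : n = m
    · subst hn; simpa using hke n hm l
    · simpa [hn] using hfe n l
  have h2 : β * ((M.updateRow i fun l => inner 𝕜 (k i) (g l)).updateRow j
      fun l => inner 𝕜 (k j) (g l)).det = -(α * ∏ m, c m) := by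
    rw [hM, ← hrow, ← hrow, hpair, hzero _ j (by simpa using hkf j (Or.inr rfl)), hdiag, zero_sub]
    intro n l
    by_cases hnj : n = j
    · subst hnj; simpa using hke n (Or.inr rfl) l
    · by_cases hni : n = i
      · subst hni; simpa [hnj] using hke n (Or.inl rfl) l
      · simpa [hni, hnj] using hfe n l
  have h3 : β * (M.updateRow i fun l => inner 𝕜 (k j) (g l)).det = 0 := by
    rw [hM, ← hrow, hpair, hzero _ i (by simpa using hkf j (Or.inr rfl)),
      Matrix.det_eq_zero_of_column_eq_zero i, mul_zero, sub_zero]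
    intro n
    rw [Matrix.of_apply]
    by_cases hn : n = i
    · subst hn; simpa [hij.symm] using hke j (Or.inr rfl) n
    · simpa [hn] using hfe n i
  have hP := Matrix.det_mul_det_updateRow_updateRow M hdet hij
    (fun l => inner 𝕜 (k i) (g l)) (fun l => inner 𝕜 (k j) (g l))
  have h1i := h1 i (Or.inl rfl)
  have h1j := h1 j (Or.inr rfl)
  set p := α * ∏ m, c m
  have h5 : (1 - p) * (-p) = (-p) * (-p) := by
    rw [← h0]
    nth_rewrite 1 [← h2]
    rw [mul_mul_mul_comm, hP, mul_sub, ← mul_mul_mul_comm, h1i, h1j, ← mul_mul_mul_comm, h3,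
      zero_mul, sub_zero]
  linear_combination -h5

end TriangleEqualityCases

section TriangleEqualityNecessity

variable {𝕜 X : Type*} [RCLike 𝕜] [NormedAddCommGroup X] [InnerProductSpace 𝕜 X]
  [FiniteDimensional 𝕜 X]
variable {ι : Type*} [Fintype ι] [DecidableEq ι]

omit [Fintype ι] in
theorem inner_principal {V : Submodule 𝕜 X} {e f : ι → X} {c : ι → ℝ} (hf : Orthonormal 𝕜 f)
    (hfV : ∀ i, f i ∈ V) (hP : ∀ i, V.starProjection (e i) = (c i : 𝕜) • f i) (i j : ι) :
    inner 𝕜 (e i) (f j) = if i = j then (c i : 𝕜) else 0 := by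
  rw [← Submodule.starProjection_eq_self_iff.mpr (hfV j),
    ← Submodule.inner_starProjection_left_eq_right, hP, inner_smul_left,
    orthonormal_iff_ite.mp hf, RCLike.conj_ofReal, mul_ite, mul_one, mul_zero]

omit [Fintype ι] in
theorem inner_principal' {V : Submodule 𝕜 X} {e f : ι → X} {c : ι → ℝ} (hf : Orthonormal 𝕜 f)
    (hfV : ∀ i, f i ∈ V) (hP : ∀ i, V.starProjection (e i) = (c i : 𝕜) • f i) (i j : ι) :
    inner 𝕜 (f i) (e j) = if i = j then (c i : 𝕜) else 0 := by
  rw [← inner_conj_symm, inner_principal hf hfV hP]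
  by_cases h : i = j
  · subst h; simp
  · simp [h, Ne.symm h]

theorem inner_blade_principal {V : Submodule 𝕜 X} {e f : ι → X} {c : ι → ℝ}
    (hf : Orthonormal 𝕜 f) (hfV : ∀ i, f i ∈ V)
    (hP : ∀ i, V.starProjection (e i) = (c i : 𝕜) • f i) :
    inner 𝕜 (blade 𝕜 e) (blade 𝕜 f) = ((∏ i, c i : ℝ) : 𝕜) := by
  rw [inner_blade, RCLike.ofReal_prod, ← Matrix.det_diagonal]
  congr 1
  ext i j
  rw [Matrix.of_apply, inner_principal hf hfV hP, Matrix.diagonal_apply]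

theorem inner_blade_starProjection_left (W : Submodule 𝕜 X) {e g : ι → X} (hg : ∀ i, g i ∈ W) :
    inner 𝕜 (blade 𝕜 fun i => W.starProjection (e i)) (blade 𝕜 g) =
      inner 𝕜 (blade 𝕜 e) (blade 𝕜 g) := by
  rw [inner_blade, inner_blade]
  congr 1
  ext i j
  rw [Matrix.of_apply, Matrix.of_apply, Submodule.inner_starProjection_left_eq_right,
    Submodule.starProjection_eq_self_iff.mpr (hg j)]

/-- Equality of Grassmann angles forces equality in the chain
`cos Θ(U, W) ≥ |⟪x, z⟫| ≥ cos (Θ(U, V) + Θ(U', W)) ≥ cos (Θ(U, V) + Θ(V, W))`, where `x`, `y`, `z`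
are the unit Plücker vectors of `U`, of its projection `U'` to `V`, and of the projection of `U'`
to `W`. -/
theorem exists_blade_eq_add {U V W : Submodule 𝕜 X} {e f : ι → X} {c : ι → ℝ}
    (he : Orthonormal 𝕜 e) (heU : Submodule.span 𝕜 (Set.range e) = U) (hf : Orthonormal 𝕜 f)
    (hfV : ∀ i, f i ∈ V) (hP : ∀ i, V.starProjection (e i) = (c i : 𝕜) • f i)
    (hcos : grassmannCos U V = ∏ i, c i) (hVW : grassmannCos V W ≠ 0)
    (hang : grassmannAngle U W = grassmannAngle U V + grassmannAngle V W) :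
    (Submodule.span 𝕜 (Set.range f))ᗮ ⊓ V ≤ W ∧
      blade 𝕜 (fun i => W.starProjection (f i)) ≠ 0 ∧
      ∃ α β : ℝ, 0 ≤ α ∧ α ≤ grassmannCos U V ∧
        blade 𝕜 f = (α : 𝕜) • blade 𝕜 e +
          (β : 𝕜) • blade 𝕜 (fun i => W.starProjection (f i)) := by
  set U' := Submodule.span 𝕜 (Set.range f) with hU'
  have hU'V : U' ≤ V :=
    Submodule.span_le.mpr (Set.range_subset_iff.mpr hfV)
  set g : ι → X := fun i => W.starProjection (f i) with hg
  have hgW : ∀ i, g i ∈ W := fun i => W.starProjection_apply_mem _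
  set r := grassmannCos U' W with hr
  have hrg : r = ‖blade 𝕜 g‖ := grassmannCos_eq_norm_blade W hf rfl
  obtain ⟨hle, hB⟩ := grassmannCos_le_of_le W hU'V
  have hrpos : 0 < r := (lt_of_le_of_ne (grassmannCos_nonneg V W) (Ne.symm hVW)).trans_le hle
  have hr0 : (r : 𝕜) ≠ 0 := by exact_mod_cast hrpos.ne'
  have hg0 : blade 𝕜 g ≠ 0 := norm_ne_zero_iff.mp (hrg ▸ hrpos.ne')
  set a := grassmannAngle U V with ha
  set b := grassmannAngle V W with hb
  set b' := grassmannAngle U' W with hb'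
  have ha0 : 0 ≤ a := grassmannAngle_nonneg _ _
  have hb0 : 0 ≤ b' := grassmannAngle_nonneg _ _
  have hbb : b' ≤ b := by
    rw [hb', hb, grassmannAngle_eq_arccos, grassmannAngle_eq_arccos]
    exact Real.arccos_le_arccos hle
  have hab : a + b ≤ Real.pi / 2 := hang ▸ grassmannAngle_le_pi_div_two U W
  have hpi := Real.pi_pos
  set x := blade 𝕜 e with hx
  set y := blade 𝕜 f with hy
  set z := ((r⁻¹ : ℝ) : 𝕜) • blade 𝕜 g with hz
  have hx1 : ‖x‖ = 1 := norm_blade_of_orthonormal he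
  have hy1 : ‖y‖ = 1 := norm_blade_of_orthonormal hf
  have hz1 : ‖z‖ = 1 := by
    rw [hz, norm_smul, RCLike.norm_ofReal, abs_of_pos (inv_pos.mpr hrpos), ← hrg,
      inv_mul_cancel₀ hrpos.ne']
  have hxy : RCLike.re (inner 𝕜 x y) = Real.cos a := by
    rw [inner_blade_principal hf hfV hP, RCLike.ofReal_re, ha, cos_grassmannAngle, hcos]
  have hyz : RCLike.re (inner 𝕜 y z) = Real.cos b' := by
    rw [hz, inner_smul_right, ← inner_blade_starProjection_left W hgW,
      inner_self_eq_norm_sq_to_K, ← hrg, hb', cos_grassmannAngle, RCLike.re_ofReal_mul,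
      ← RCLike.ofReal_pow, RCLike.ofReal_re, ← hr]
    field_simp
  obtain ⟨h1, h2⟩ := cos_add_le_re_inner hx1 hy1 hz1 ha0 hb0 (by linarith) hxy hyz
  have h3 : RCLike.re (inner 𝕜 x z) ≤ Real.cos (a + b) := by
    have h4 : inner 𝕜 x z = inner 𝕜 (blade 𝕜 fun i => W.starProjection (e i)) z := by
      rw [hz, inner_smul_right, inner_smul_right, inner_blade_starProjection_left W hgW]
    rw [← hang, cos_grassmannAngle, grassmannCos_eq_norm_blade W he heU, h4]
    refine (RCLike.re_le_norm _).trans ((norm_inner_le_norm _ _).trans ?_)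
    rw [hz1, mul_one]
  have h5 : Real.cos (a + b) ≤ Real.cos (a + b') :=
    Real.cos_le_cos_of_nonneg_of_le_pi (by linarith) (by linarith) (by linarith)
  have h6 : a + b' = a + b :=
    Real.injOn_cos ⟨by linarith, by linarith⟩ ⟨by linarith, by linarith⟩ (by linarith)
  have h7 : r = grassmannCos V W := by
    rw [hr, ← cos_grassmannAngle, ← cos_grassmannAngle, ← hb', ← hb, add_left_cancel h6]
  obtain ⟨α, β, hα, hβ, hrel⟩ := h2 (h3.trans h5)
  refine ⟨hB hVW h7.le, hg0, α, β * r⁻¹, hα, ?_, ?_⟩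
  · -- pairing `y = α x + β z` with `x`
    have h8 : RCLike.re (inner 𝕜 x y) = α + β * RCLike.re (inner 𝕜 x z) := by
      rw [hrel, inner_add_right, inner_smul_right, inner_smul_right, map_add,
        RCLike.re_ofReal_mul, RCLike.re_ofReal_mul, inner_self_eq_norm_sq, hx1]
      ring
    have h9 : 0 ≤ Real.cos (a + b') :=
      Real.cos_nonneg_of_neg_pi_div_two_le_of_le (by linarith) (by linarith)
    rw [hxy, ha, cos_grassmannAngle] at h8
    have := mul_nonneg hβ (h9.trans h1)
    linarith
  · rw [hrel, hz, smul_smul, RCLike.ofReal_mul]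

omit [FiniteDimensional 𝕜 X] [Fintype ι] [DecidableEq ι] in
theorem span_range_eq_sup_image (e : ι → X) (i : ι) :
    Submodule.span 𝕜 (Set.range e) =
      Submodule.span 𝕜 {e i} ⊔ Submodule.span 𝕜 (e '' {i}ᶜ) := by
  rw [← Submodule.span_union, ← Set.image_singleton, ← Set.image_union, Set.union_compl_self,
    Set.image_univ]

/-- With a single nonzero principal angle, at the index `i`, the relation `f = α e + β g` of
Plücker vectors becomes `w = f i - α e i ∈ W`. -/
theorem exists_isAlignedDecomposition {U V W : Submodule 𝕜 X} {e f : ι → X} {c : ι → ℝ}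
    {α β : ℝ} {i : ι}
    (he : Orthonormal 𝕜 e) (heU : Submodule.span 𝕜 (Set.range e) = U) (hf : Orthonormal 𝕜 f)
    (hfV : ∀ i, f i ∈ V) (hP : ∀ i, V.starProjection (e i) = (c i : 𝕜) • f i)
    (hB : (Submodule.span 𝕜 (Set.range f))ᗮ ⊓ V ≤ W)
    (hg : blade 𝕜 (fun i => W.starProjection (f i)) ≠ 0) (hα : 0 < α) (hαc : α ≤ c i)
    (hβ : β ≠ 0) (hci : c i ≠ 1) (hef : ∀ m, m ≠ i → e m = f m)
    (hrel : blade 𝕜 f = (α : 𝕜) • blade 𝕜 e +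
      (β : 𝕜) • blade 𝕜 (fun i => W.starProjection (f i))) :
    ∃ (u v w : X) (a b : ℝ) (A B C : Submodule 𝕜 X),
      IsAlignedDecomposition U V W u v w a b A B C := by
  have hie := orthonormal_iff_ite.mp he
  have hief := inner_principal hf hfV hP
  have hα0 : (α : 𝕜) ≠ 0 := by exact_mod_cast hα.ne'
  set g : ι → X := fun i => W.starProjection (f i) with hgdef
  set w := f i - (α : 𝕜) • e i with hw
  set h : ι → X := Function.update f i w with hh
  have hbl : blade 𝕜 h = (β : 𝕜) • blade 𝕜 g := by
    have h1 := blade_update_add (𝕜 := 𝕜) f i w ((α : 𝕜) • e i)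
    have h2 : Function.update f i (e i) = e := by
      ext m
      by_cases hm : m = i
      · subst hm; simp
      · simp [hm, hef m hm]
    rw [hw, sub_add_cancel, Function.update_eq_self, blade_update_smul, h2, ← hw, ← hh, hrel,
      add_comm] at h1
    exact (add_right_cancel h1).symm
  have hβ0 : (β : 𝕜) ≠ 0 := by exact_mod_cast hβ
  have hspan := span_range_eq_of_blade_eq_smul hβ0 hg hbl
  have hhW : ∀ m, h m ∈ W := by
    intro m
    have h1 : Submodule.span 𝕜 (Set.range g) ≤ W :=
    Submodule.span_le.mpr (Set.range_subset_iff.mpr fun _ => W.starProjection_apply_mem _)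
    exact h1 (hspan ▸ Submodule.subset_span (Set.mem_range_self m))
  have hwW : w ∈ W := by simpa [hh] using hhW i
  have hfW : ∀ m, m ≠ i → f m ∈ W := fun m hm => by simpa [hh, hm] using hhW m
  have huw : inner 𝕜 (e i) w = ((c i - α : ℝ) : 𝕜) := by
    rw [hw, inner_sub_right, inner_smul_right, hief, hie]
    simp
  have hw0 : w ≠ 0 := by
    intro h0
    have h1 : f i = (α : 𝕜) • e i := sub_eq_zero.mp h0
    have h2 : α = 1 := by
      have := congrArg norm h1
      rw [norm_smul, hf.1, he.1, RCLike.norm_ofReal, abs_of_pos hα, mul_one] at this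
      exact this.symm
    rw [h0, inner_zero_right] at huw
    have h3 : c i - α = 0 := by exact_mod_cast huw.symm
    exact hci (by linarith)
  set A := Submodule.span 𝕜 (e '' {i}ᶜ) with hA
  set B := (Submodule.span 𝕜 (Set.range f))ᗮ ⊓ V with hBdef
  set C := (Submodule.span 𝕜 {w} ⊔ A ⊔ B)ᗮ ⊓ W with hC
  -- orthogonality to `span {u, w}` is tested on `u = e i` and `f i = α u + w`
  have hortho : ∀ D : Submodule 𝕜 X, (∀ x ∈ D, inner 𝕜 x (e i) = 0 ∧ inner 𝕜 x w = 0) →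
      D ⟂ Submodule.span 𝕜 {e i, w} := by
    intro D hD
    rw [Submodule.isOrtho_iff_le]
    intro x hx
    rw [Submodule.mem_orthogonal']
    intro y hy
    obtain ⟨s, t, rfl⟩ := Submodule.mem_span_pair.mp hy
    rw [inner_add_right, inner_smul_right, inner_smul_right, (hD x hx).1, (hD x hx).2]
    simp
  have hAfi : ∀ x ∈ A, inner 𝕜 x (e i) = 0 ∧ inner 𝕜 x w = 0 := by
    intro x hx
    rw [hA] at hx
    induction hx using Submodule.span_induction with
    | mem x hx =>
      obtain ⟨m, hm, rfl⟩ := hx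
      have hm' : m ≠ i := hm
      have h1 : inner 𝕜 (e m) (e i) = 0 := by rw [hie, if_neg hm']
      refine ⟨h1, ?_⟩
      rw [hw, inner_sub_right, inner_smul_right, h1, hief, if_neg hm', mul_zero, sub_zero]
    | zero => simp
    | add x y _ _ hx hy => simp [inner_add_left, hx.1, hx.2, hy.1, hy.2]
    | smul s x _ hx => simp [inner_smul_left, hx.1, hx.2]
  have hAf : A ≤ Submodule.span 𝕜 (Set.range f) := by
    rw [hA, Submodule.span_le]
    rintro _ ⟨m, hm, rfl⟩
    rw [hef m hm]
    exact Submodule.subset_span (Set.mem_range_self m)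
  have hAW : A ≤ W := by
    rw [hA, Submodule.span_le]
    rintro _ ⟨m, hm, rfl⟩
    rw [hef m hm]
    exact hfW m hm
  have hle : Submodule.span 𝕜 {w} ⊔ A ⊔ B ≤ W :=
    sup_le (sup_le ((Submodule.span_singleton_le_iff_mem _ _).mpr hwW) hAW) hB
  have hAB : A ⟂ B := (isOrtho_orthogonal_inf _ V).mono_left hAf
  have hsupC : Submodule.span 𝕜 {w} ⊔ A ⊔ B ⟂ C := isOrtho_orthogonal_inf _ W
  refine ⟨e i, f i, w, α, 1, A, B, C, he.ne_zero i, hw0, ?_, ?_, hα, one_pos, ?_,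
    hortho A hAfi, hortho B ?_, hortho C ?_, hAB,
    hsupC.mono_left (le_sup_right.trans le_sup_left), hsupC.mono_left le_sup_right, ?_, ?_, ?_⟩
  · rw [huw, RCLike.ofReal_im]
  · rw [huw, RCLike.ofReal_re]
    linarith
  · rw [hw, RCLike.ofReal_one, one_smul, add_sub_cancel]
  · intro x hx
    have h1 : inner 𝕜 x (f i) = 0 := Submodule.inner_left_of_mem_orthogonal
      (Submodule.subset_span (Set.mem_range_self i)) hx.1
    have h2 : inner 𝕜 x (e i) = 0 := by
      rw [← Submodule.starProjection_eq_self_iff.mpr hx.2,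
        Submodule.inner_starProjection_left_eq_right, hP, inner_smul_right, h1, mul_zero]
    refine ⟨h2, ?_⟩
    rw [hw, inner_sub_right, inner_smul_right, h1, h2, mul_zero, sub_zero]
  · intro x hx
    have h1 : inner 𝕜 x w = 0 := Submodule.inner_left_of_mem_orthogonal
      ((le_sup_left.trans le_sup_left : Submodule.span 𝕜 {w} ≤ _)
        (Submodule.mem_span_singleton_self w)) hx.1
    -- `x` is orthogonal to the `h m`, hence to the projections `g m`, hence to the `f m`
    have h2 : ∀ m, inner 𝕜 x (h m) = 0 := by
      intro m
      by_cases hm : m = i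
      · subst hm; simpa [hh] using h1
      · have h3 : f m ∈ A := hef m hm ▸ Submodule.subset_span (Set.mem_image_of_mem e hm)
        simpa [hh, hm] using Submodule.inner_left_of_mem_orthogonal
          ((le_sup_right.trans le_sup_left : A ≤ _) h3) hx.1
    have h4 : inner 𝕜 x (f i) = 0 := by
      have h5 := inner_eq_zero_of_blade_eq_smul hβ0 hg hbl h2 i
      rwa [hgdef, ← Submodule.inner_starProjection_left_eq_right,
        Submodule.starProjection_eq_self_iff.mpr hx.2] at h5
    have h6 : (α : 𝕜) * inner 𝕜 x (e i) = 0 := by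
      rw [hw, inner_sub_right, inner_smul_right, h4, zero_sub, neg_eq_zero] at h1
      exact h1
    exact ⟨(mul_eq_zero.mp h6).resolve_left hα0, h1⟩
  · rw [← heU, hA, ← span_range_eq_sup_image]
  · have h1 : Submodule.span 𝕜 (Set.range f) ≤ V :=
    Submodule.span_le.mpr (Set.range_subset_iff.mpr hfV)
    have h2 : A = Submodule.span 𝕜 (f '' {i}ᶜ) := by
      exact hA.trans (congrArg _ (Set.image_congr fun m (hm : m ∈ ({i}ᶜ : Set ι)) => hef m hm))
    rw [h2, ← span_range_eq_sup_image, hBdef,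
      Submodule.sup_orthogonal_inf_of_hasOrthogonalProjection h1]
  · rw [hC, Submodule.sup_orthogonal_inf_of_hasOrthogonalProjection hle]

/-- Both cosines equal `∏ c`, so the Plücker vector of the projections of `e` to `W` attains equality
in the Cauchy–Schwarz inequality with that of `f`, and spans the same subspace. -/
theorem map_starProjection_le_of_grassmannCos_eq {U V W : Submodule 𝕜 X} (hVW : V ≤ W)
    (h0 : grassmannCos U W ≠ 0) (h : grassmannCos U V = grassmannCos U W) :
    U.map (W.starProjection : X →ₗ[𝕜] X) ≤ V := by
  have hrank := finrank_le_of_grassmannCos_ne_zero (h ▸ h0)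
  obtain ⟨e, f, c, he, heU, hf, hfV, -, hP, hcos⟩ := exists_principal_family hrank
  have hb : blade 𝕜 (fun i => W.starProjection (e i)) =
      ((grassmannCos U W : ℝ) : 𝕜) • blade 𝕜 f := by
    refine eq_smul_of_inner_eq_norm (norm_blade_of_orthonormal hf)
      (grassmannCos_eq_norm_blade W he heU).symm ?_
    rw [inner_blade_starProjection_left W fun i => hVW (hfV i), inner_blade_principal hf hfV hP,
      ← hcos, h]
  have hf0 : blade 𝕜 f ≠ 0 := by
    rw [← norm_ne_zero_iff, norm_blade_of_orthonormal hf]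
    exact one_ne_zero
  have hs := span_range_eq_of_blade_eq_smul (by exact_mod_cast h0) hf0 hb
  rw [← heU, Submodule.map_span, ← Set.range_comp]
  exact hs.symm.le.trans (Submodule.span_le.mpr (Set.range_subset_iff.mpr hfV))

theorem conditions_of_grassmannAngle_eq_add {U V W : Submodule 𝕜 X}
    (hang : grassmannAngle U W = grassmannAngle U V + grassmannAngle V W) :
    (U ≤ V ∧ (PartiallyOrthogonal U W ∨ Uᗮ ⊓ V ≤ W)) ∨
      (V ≤ W ∧ (PartiallyOrthogonal U W ∨ U.map (W.starProjection : X →ₗ[𝕜] X) ≤ V)) ∨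
      ∃ (u v w : X) (a b : ℝ) (A B C : Submodule 𝕜 X),
        IsAlignedDecomposition U V W u v w a b A B C := by
  have hUV0 := grassmannAngle_nonneg U V
  have hVW0 := grassmannAngle_nonneg V W
  have hUW2 := grassmannAngle_le_pi_div_two U W
  by_cases hVW : V ≤ W
  · refine Or.inr (Or.inl ⟨hVW, ?_⟩)
    by_cases h0 : grassmannCos U W = 0
    · exact Or.inl (grassmannCos_eq_zero_iff.mp h0)
    · rw [grassmannAngle_eq_zero_iff.mpr hVW, add_zero] at hang
      refine Or.inr (map_starProjection_le_of_grassmannCos_eq hVW h0 ?_)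
      rw [← cos_grassmannAngle, ← cos_grassmannAngle, hang]
  have hVWpos : 0 < grassmannAngle V W :=
    lt_of_le_of_ne hVW0 fun h => hVW (grassmannAngle_eq_zero_iff.mp h.symm)
  have hUV : grassmannCos U V ≠ 0 := by
    rw [Ne, grassmannCos_eq_zero_iff, ← grassmannAngle_eq_pi_div_two_iff]
    intro h
    linarith
  by_cases hVWc : grassmannCos V W = 0
  · rw [grassmannCos_eq_zero_iff, ← grassmannAngle_eq_pi_div_two_iff] at hVWc
    exact Or.inl ⟨grassmannAngle_eq_zero_iff.mp (by linarith),
      Or.inl (grassmannAngle_eq_pi_div_two_iff.mp (by linarith))⟩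
  have hrank := finrank_le_of_grassmannCos_ne_zero hUV
  obtain ⟨e, f, c, he, heU, hf, hfV, hc0, hP, hcos⟩ := exists_principal_family hrank
  obtain ⟨hB, hg, α, β, hα, hαc, hrel⟩ :=
    exists_blade_eq_add he heU hf hfV hP hcos hVWc hang
  have hc1 : ∀ i, c i ≤ 1 := by
    intro i
    have h1 := V.norm_starProjection_apply_le (e i)
    rwa [hP, norm_smul, hf.1, he.1, RCLike.norm_ofReal, abs_of_nonneg (hc0 i), mul_one] at h1
  have hef : ∀ i, c i = 1 → e i = f i := by
    intro i hi
    have h1 : inner 𝕜 (e i) (f i) = ((1 : ℝ) : 𝕜) := by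
      rw [inner_principal hf hfV hP, if_pos rfl, hi]
    simpa using eq_smul_of_inner_eq_norm (hf.1 i) (he.1 i) h1
  by_cases hall : ∀ i, c i = 1
  · -- all principal angles vanish, so `U ≤ V` and `U` is its own projection
    have h1 : e = f := funext fun i => hef i (hall i)
    refine Or.inl ⟨?_, Or.inr ?_⟩
    · rw [← grassmannCos_eq_one_iff, hcos]
      simp [hall]
    · rwa [← h1, heU] at hB
  push Not at hall
  obtain ⟨i, hi⟩ := hall
  have hprod : ∏ m, c m ≠ 0 := hcos ▸ hUV
  have hUVlt : grassmannCos U V ≠ 1 := by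
    intro h
    rw [hcos] at h
    have h1 : ∏ m, c m ≤ c i := by
      rw [← Finset.mul_prod_erase _ _ (Finset.mem_univ i)]
      exact mul_le_of_le_one_right (hc0 i)
        (Finset.prod_le_one (fun m _ => hc0 m) fun m _ => hc1 m)
    exact hi (le_antisymm (hc1 i) (h ▸ h1))
  -- `α = 0` would give `U' ≤ W` and hence `V ≤ W`
  have hα0 : α ≠ 0 := by
    intro h
    rw [h, RCLike.ofReal_zero, zero_smul, zero_add] at hrel
    have hβ : (β : 𝕜) ≠ 0 := by
      intro hβ
      rw [hβ, zero_smul] at hrel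
      have := norm_blade_of_orthonormal hf
      rw [hrel, norm_zero] at this
      exact zero_ne_one this
    have h1 := span_range_eq_of_blade_eq_smul hβ hg hrel
    have h2 : Submodule.span 𝕜 (Set.range f) ≤ V :=
    Submodule.span_le.mpr (Set.range_subset_iff.mpr hfV)
    refine hVW ?_
    rw [← Submodule.sup_orthogonal_inf_of_hasOrthogonalProjection h2, ← h1]
    exact sup_le (Submodule.span_le.mpr (Set.range_subset_iff.mpr fun _ =>
      W.starProjection_apply_mem _)) (h1 ▸ hB)
  -- `β = 0` would make `x` and `y` parallel
  have hβ0 : β ≠ 0 := by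
    intro h
    rw [h, RCLike.ofReal_zero, zero_smul, add_zero] at hrel
    have h1 := congrArg norm hrel
    rw [norm_smul, norm_blade_of_orthonormal hf, norm_blade_of_orthonormal he,
      RCLike.norm_ofReal, abs_of_nonneg hα, mul_one] at h1
    exact hUVlt (le_antisymm (grassmannCos_le_one _ _) (h1 ▸ hαc))
  have honly : ∀ m, m ≠ i → c m = 1 := by
    intro m hm
    by_contra hm1
    set k : Fin (finrank 𝕜 U) → X := fun n =>
      ((c n / (1 - c n ^ 2) : ℝ) : 𝕜) • (e n - (c n : 𝕜) • f n) with hk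
    have hkf : ∀ n l, inner 𝕜 (k n) (f l) = 0 := by
      intro n l
      rw [hk, inner_smul_left, inner_sub_left, inner_smul_left, inner_principal hf hfV hP,
        orthonormal_iff_ite.mp hf, RCLike.conj_ofReal, RCLike.conj_ofReal]
      split_ifs <;> simp
    have hke : ∀ n, c n ≠ 1 → ∀ l, inner 𝕜 (k n) (e l) = if n = l then (c n : 𝕜) else 0 := by
      intro n hn l
      have hn2 : 1 - c n ^ 2 ≠ 0 := by
        intro h
        exact hn ((pow_eq_one_iff_of_nonneg (hc0 n) two_ne_zero).mp (sub_eq_zero.mp h).symm)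
      rw [hk, inner_smul_left, inner_sub_left, inner_smul_left, inner_principal' hf hfV hP,
        orthonormal_iff_ite.mp he, RCLike.conj_ofReal, RCLike.conj_ofReal]
      split_ifs
      · have h2 : c n / (1 - c n ^ 2) * (1 - c n * c n) = c n := by
          rw [← sq, div_mul_cancel₀ _ hn2]
        exact_mod_cast congrArg (RCLike.ofReal (K := 𝕜)) h2
      · simp
    have hdet : inner 𝕜 (blade 𝕜 f) (blade 𝕜 fun i => W.starProjection (f i)) ≠ 0 := by
      rw [← inner_blade_starProjection_left W fun i => W.starProjection_apply_mem _]
      exact inner_self_ne_zero.mpr hg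
    have h1 := mul_prod_eq_zero_of_blade_eq_add (c := fun n => (c n : 𝕜)) hm hf
      (inner_principal' hf hfV hP) (fun n _ => hkf n)
      (fun n hn => hke n (by rcases hn with rfl | rfl <;> assumption)) hdet hrel
    rw [← RCLike.ofReal_prod, ← RCLike.ofReal_mul, RCLike.ofReal_eq_zero] at h1
    exact mul_ne_zero hα0 hprod h1
  have hci : ∏ m, c m = c i :=
    Finset.prod_eq_single i (fun m _ hm => honly m hm) fun h => absurd (Finset.mem_univ i) h
  exact Or.inr (Or.inr (exists_isAlignedDecomposition he heU hf hfV hP hB hg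
    (lt_of_le_of_ne hα hα0.symm) (hci ▸ hcos ▸ hαc) hβ0 hi (fun m hm => hef m (honly m hm)) hrel))

end TriangleEqualityNecessity

theorem mainTheorem2 {𝕜 X : Type*} [RCLike 𝕜] [NormedAddCommGroup X] [InnerProductSpace 𝕜 X]
    [FiniteDimensional 𝕜 X] (U V W : Submodule 𝕜 X) :
    (grassmannAngle U W = grassmannAngle U V + grassmannAngle V W ↔
      (U ≤ V ∧ (PartiallyOrthogonal U W ∨ Uᗮ ⊓ V ≤ W)) ∨
      (V ≤ W ∧ (PartiallyOrthogonal U W ∨ U.map (W.starProjection : X →ₗ[𝕜] X) ≤ V)) ∨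
      ∃ (u v w : X) (a b : ℝ) (A B C : Submodule 𝕜 X),
        IsAlignedDecomposition U V W u v w a b A B C) ∧
    ∀ (u v w : X) (a b : ℝ) (A B C : Submodule 𝕜 X),
      IsAlignedDecomposition U V W u v w a b A B C →
        euclideanAngle 𝕜 u v = grassmannAngle U V ∧
        euclideanAngle 𝕜 u w = grassmannAngle U W ∧
        euclideanAngle 𝕜 v w = grassmannAngle V W := by
  refine ⟨⟨conditions_of_grassmannAngle_eq_add, ?_⟩,
    fun u v w a b A B C h => h.euclideanAngle_eq⟩
  rintro (⟨hUV, h⟩ | ⟨hVW, h⟩ | ⟨u, v, w, a, b, A, B, C, h⟩)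
  · exact grassmannAngle_eq_add_of_le_left hUV h
  · exact grassmannAngle_eq_add_of_le_right hVW h
  · exact h.grassmannAngle_eq_add
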